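/- Let $\mathcal K$ be the space of convex bodies (compact convex sets) in $\mathbb R^d$ containing the origin in their interior, with the Borel $\sigma$-field of the Hausdorff metric. Let $\mathbf N$ be the space of countable sets $\psi\subset\mathbb R^d\times[0,\infty)\times\mathcal K$ that have finitely many points $(x,t,K)$ with $x\in B$ for each bounded $B\subset\mathbb R^d$, and whose different points have different positions $x$; equip $\mathbf N$ with the smallest $\sigma$-field making all maps $\psi\mapsto\operatorname{card}(\psi\cap C)$, $C$ measurable, measurable. A family of growth times $R(u)\in[0,\infty)$, $u\in\psi$, is called *growth-maximal* on $\psi$ if, writing $u=(x_u,t_u,K_u)$ and $u^*=x_u+R(u)K_u$, (i) the interiors of $u^*$ and $v^*$ are disjoint for all $u\ne v$ in $\psi$; (ii) if $R(u)=0$, there is $v\in\psi$, $v\neq u$, with $R(v)>0$, $x_u\in v^*$ and $t_u\ge t_v+\inf\{r\ge0: x_u\in x_v+rK_v\}$; (iii) if $R(u)>0$, there is $v\in\psi$, $v\ne u$, with $R(v)>0$, $t_u+R(u)\ge t_v+R(v)$ and $u^*\cap v^*\neq\emptyset$. Let $\Psi$ be a random element of $\mathbf N$, defined on a probability space, that is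 almost surely either infinite or empty. Let $\nu^{(k)}$ be its $k$-th factorial moment measure, i.e. $\nu^{(k)}(C)$ is the expected number of $k$-tuples of pairwise different points of $\Psi$ that belong to $C\subset(\mathbb R^d\times[0,\infty)\times\mathcal K)^k$. Assume that there are $a>0$ and a probability measure $\mathbb Q$ on $[0,\infty)\times\mathcal K$ with $$\nu^{(k)}\le a^k(\lambda^d\otimes\mathbb Q)^k\quad(k\ge1),\qquad \int (r^{2d}+1)(\rho(K)^{2d}+1)\,\mathbb Q(d(r,K))<\infty,$$ where $\lambda^d$ is Lebesgue measure and $\rho(K)$ is the radius of the smallest ball containing $K$. Then there is a measurable function $R:\mathbf N\times(\mathbb R^d\times[0,\infty)\times\mathcal K)\to[0,\infty)$ such that almost surely $R(\Psi,\cdot)$ is growth-maximal on $\Psi$, and almost surely it is the only growth-maximal family on $\Psi$. In particular, for every enumeration $\Psi=\{(X_n,T_n,Z_n):n\ge1\}$ without repetitions, the growth times $R_n:=R(\Psi,X_n,T_n,Z_n)$ satisfy (i)–(iii) almost surely (and are $\sigma(\Psi)$-measurable if the $(X_n,T_n,Z_n)$ are), and any other family $(R_n')_{n\ge1}$ satisfying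 (i)–(iii) almost surely has $R_n'=R_n$ almost surely for each $n$. -/

import Mathlib

open MeasureTheory
open scoped NNReal ENNReal

noncomputable section

namespace GrowthModel

/-- The space of convex bodies (nonempty, compact, convex sets) in `ℝ^d` that contain the origin
in their interior. -/
def Shape (d : ℕ) : Type :=
  {K : ConvexBody (EuclideanSpace ℝ (Fin d)) //
    (0 : EuclideanSpace ℝ (Fin d)) ∈ interior (K : Set (EuclideanSpace ℝ (Fin d)))}

/-- The topology of the Hausdorff metric on shapes. -/
instance (d : ℕ) : TopologicalSpace (Shape d) :=
  inferInstanceAs (TopologicalSpace {K : ConvexBody (EuclideanSpace ℝ (Fin d)) //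
    (0 : EuclideanSpace ℝ (Fin d)) ∈ interior (K : Set (EuclideanSpace ℝ (Fin d)))})

/-- The Borel sigma-field of the Hausdorff metric. -/
instance (d : ℕ) : MeasurableSpace (Shape d) := borel (Shape d)

instance (d : ℕ) : BorelSpace (Shape d) := ⟨rfl⟩

/-- The underlying set of points of a shape. -/
def Shape.toSet {d : ℕ} (K : Shape d) : Set (EuclideanSpace ℝ (Fin d)) :=
  (K.1 : Set (EuclideanSpace ℝ (Fin d)))

/-- The circumradius `ρ(K)`: the radius of the smallest ball containing `K`. -/
def Shape.circumradius {d : ℕ} (K : Shape d) : ℝ :=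
  sInf {r : ℝ | 0 ≤ r ∧ ∃ c : EuclideanSpace ℝ (Fin d), K.toSet ⊆ Metric.closedBall c r}

/-- A grain `(x, t, K)`: position `x`, birth time `t ≥ 0`, shape `K`. -/
abbrev Grain (d : ℕ) : Type := EuclideanSpace ℝ (Fin d) × ℝ≥0 × Shape d

/-- The position of a grain. -/
def Grain.pos {d : ℕ} (u : Grain d) : EuclideanSpace ℝ (Fin d) := u.1

/-- The birth time of a grain. -/
def Grain.birth {d : ℕ} (u : Grain d) : ℝ≥0 := u.2.1

/-- The shape of a grain. -/
def Grain.shape {d : ℕ} (u : Grain d) : Shape d := u.2.2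

/-- The set `x + r K = {x + r z : z ∈ K}` occupied by the grain `(x, t, K)` after it has grown for
the time `r`. -/
def Grain.grown {d : ℕ} (u : Grain d) (r : ℝ≥0) : Set (EuclideanSpace ℝ (Fin d)) :=
  (fun z => u.pos + (r : ℝ) • z) '' u.shape.toSet

/-- The growth time `inf {r ≥ 0 : y ∈ x + r K}` that the grain `(x, t, K)` needs to reach the
point `y`. The set is never empty, since `K` contains the origin in its interior. -/
def Grain.reachTime {d : ℕ} (u : Grain d) (y : EuclideanSpace ℝ (Fin d)) : ℝ≥0 :=
  sInf {r : ℝ≥0 | y ∈ u.grown r}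

/-- The family of grains `u i = (X_i, T_i, Z_i)` with growth times `r i` is a growth-maximal
hard-core model. Here `Z_i^* = X_i + r_i Z_i` is `(u i).grown (r i)`. -/
structure IsGrowthMaximal {d : ℕ} {ι : Type*} (u : ι → Grain d) (r : ι → ℝ≥0) : Prop where
  /-- (i) the full-grown grains have pairwise disjoint interiors -/
  hardCore : ∀ m n : ι, m ≠ n →
    Disjoint (interior ((u m).grown (r m))) (interior ((u n).grown (r n)))
  /-- (ii) a grain with zero growth time lies, at its birth, in another grain -/
  earlier_of_zero : ∀ m : ι, r m = 0 → ∃ n : ι, n ≠ m ∧ 0 < r n ∧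
    (u m).pos ∈ (u n).grown (r n) ∧
    (u n).birth + (u n).reachTime (u m).pos ≤ (u m).birth
  /-- (iii) a grain with positive growth time is stopped by a grain which reached its final size
  at the same time or earlier -/
  earlier_of_pos : ∀ m : ι, 0 < r m → ∃ n : ι, n ≠ m ∧ 0 < r n ∧
    (u n).birth + r n ≤ (u m).birth + r m ∧
    ((u m).grown (r m) ∩ (u n).grown (r n)).Nonempty

/-- The space of countable sets of grains that have finitely many grains positioned in any bounded
set, and in which different grains have different positions. -/
structure Config (d : ℕ) where
  /-- the set of grains -/
  carrier : Set (Grain d)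
  countable : carrier.Countable
  locallyFinite : ∀ B : Set (EuclideanSpace ℝ (Fin d)), Bornology.IsBounded B →
    {v ∈ carrier | v.pos ∈ B}.Finite
  pos_ne : ∀ u ∈ carrier, ∀ v ∈ carrier, u ≠ v → u.pos ≠ v.pos

/-- The smallest sigma-field that makes all counting maps `ψ ↦ card (ψ ∩ C)`, with `C` measurable,
measurable. -/
instance (d : ℕ) : MeasurableSpace (Config d) :=
  ⨆ (C : Set (Grain d)) (_ : MeasurableSet C),
    MeasurableSpace.comap (fun ψ : Config d => (ψ.carrier ∩ C).encard) ⊤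

/-- The `k`-th factorial moment measure of `Ψ`, evaluated at `C`: the expected number of `k`-tuples
in `C` of pairwise different grains of `Ψ`. -/
def factorialMoment {d : ℕ} {Ω : Type*} [MeasurableSpace Ω] (P : Measure Ω) (Ψ : Ω → Config d)
    (k : ℕ) (C : Set (Fin k → Grain d)) : ℝ≥0∞ :=
  ∫⁻ ω, (({u : Fin k → Grain d |
    Function.Injective u ∧ (∀ i, u i ∈ (Ψ ω).carrier) ∧ u ∈ C}.encard : ℕ∞) : ℝ≥0∞) ∂P

end GrowthModel

end

noncomputable section

namespace GrowthModel

open Set Filter Topology Metric TopologicalSpace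

variable {d : ℕ}

/-! Let `s u` be the time at which the grain `u` stops growing. For d > 0, distinct positions and
finitely many meetings in bounded time, growth-maximality on `A` is equivalent to the fixed point
equation `s = nextEnd A s` on `A`: `u` stops as soon as it shares a point with a grain `v` that
reached the point while alive, where grains `v` born inside the freely growing `u` are disregarded
(`IsGrowthMaximal.eq_nextEnd`, `isGrowthMaximal_of_eq_nextEnd`). The operator is antitone, so
iterating it from 0 gives increasing lower and decreasing upper bounds that enclose every solution.
Existence and uniqueness both follow once the two bounds have the same limit.

The fate of `u` up to time `s` depends only on grains that `u` meets before `s`, and on those only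
up to the meeting. If this dependence (`Precedes`) is well-founded, an induction shows that the
bounds agree (`exists_forall_endUpper_le_or`). A grain growing forever would cover every other grain
at its birth, which is impossible in an infinite configuration where each grain covers finitely many
others (`endTime_ne_top`).

Well-foundedness is the probabilistic part. A descending chain has strictly decreasing meeting
times, so its tail lies in one window (jε, (j+1)ε], and loop erasure makes it injective
(`wellFounded_precedes`). The factorial moment bounds estimate the expected number of such paths
with k edges by a geometric sequence (`lintegral_isPath_le`, `ae_not_exists_path`). Its ratio is
small because a grain born before the window finds its new neighbours in a thin boundary layer of a
convex set, of volume O(1/n²) for ε of order 1/n². A grain born during the window has no such bound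
for neighbours born earlier; giving grains born in the window the weight n, and all others the
weight 1, leaves a ratio O(1/n) in every case (`natCast_mul_volume_windowEdge_le`). -/

/-! ### Gauges of shapes and freely growing grains. -/

lemma Shape.convex (K : Shape d) : Convex ℝ K.toSet := K.1.convex
lemma Shape.isCompact (K : Shape d) : IsCompact K.toSet := K.1.isCompact
lemma Shape.mem_nhds (K : Shape d) : K.toSet ∈ 𝓝 (0 : EuclideanSpace ℝ (Fin d)) :=
  mem_interior_iff_mem_nhds.1 K.2
lemma Shape.zero_mem (K : Shape d) : (0 : EuclideanSpace ℝ (Fin d)) ∈ K.toSet :=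
  mem_of_mem_nhds K.mem_nhds

/-- Boundedness of `K` settles r = 0 and closedness settles r > 0. This turns all growth statements
into inequalities between gauges. -/
lemma Shape.gauge_le_iff (K : Shape d) {r : ℝ} (hr : 0 ≤ r) (z : EuclideanSpace ℝ (Fin d)) :
    gauge K.toSet z ≤ r ↔ z ∈ (fun w => r • w) '' K.toSet := by
  have habs : Absorbent ℝ K.toSet := absorbent_nhds_zero K.mem_nhds
  have hb : Bornology.IsVonNBounded ℝ K.toSet := NormedSpace.isVonNBounded_of_isBounded ℝ K.isCompact.isBounded
  rcases hr.eq_or_lt with rfl | hr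
  · have : gauge K.toSet z ≤ 0 ↔ z = 0 := by
      rw [← gauge_eq_zero habs hb]
      exact ⟨fun h => le_antisymm h (gauge_nonneg z), fun h => h.le⟩
    rw [this]
    constructor
    · rintro rfl
      exact ⟨0, K.zero_mem, by simp⟩
    · rintro ⟨w, -, rfl⟩
      simp
  · have h1 : gauge K.toSet z ≤ r ↔ gauge K.toSet (r⁻¹ • z) ≤ 1 := by
      rw [gauge_smul_of_nonneg (inv_nonneg.2 hr.le), smul_eq_mul, inv_mul_le_iff₀ hr, mul_one]
    rw [h1, gauge_le_one_iff_mem_closure K.convex K.mem_nhds, K.isCompact.isClosed.closure_eq]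
    constructor
    · intro h
      exact ⟨_, h, by simp [smul_smul, hr.ne']⟩
    · rintro ⟨w, hw, rfl⟩
      simpa [smul_smul, hr.ne'] using hw

namespace Grain

lemma mem_grown_iff_gauge (u : Grain d) (r : ℝ≥0) (y : EuclideanSpace ℝ (Fin d)) :
    y ∈ u.grown r ↔ gauge u.shape.toSet (y - u.pos) ≤ r := by
  rw [u.shape.gauge_le_iff r.coe_nonneg]
  simp only [grown, mem_image]
  refine exists_congr fun w => and_congr_right fun _ => ?_
  rw [eq_sub_iff_add_eq']

lemma reachTime_eq (u : Grain d) (y : EuclideanSpace ℝ (Fin d)) :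
    u.reachTime y = (gauge u.shape.toSet (y - u.pos)).toNNReal := by
  have : {r : ℝ≥0 | y ∈ u.grown r} = Ici (gauge u.shape.toSet (y - u.pos)).toNNReal := by
    ext r
    rw [mem_Ici, Real.toNNReal_le_iff_le_coe, ← mem_grown_iff_gauge]
    rfl
  rw [reachTime, this, csInf_Ici]

lemma coe_reachTime (u : Grain d) (y : EuclideanSpace ℝ (Fin d)) :
    (u.reachTime y : ℝ) = gauge u.shape.toSet (y - u.pos) := by
  rw [reachTime_eq, Real.coe_toNNReal _ (gauge_nonneg _)]

lemma mem_grown_iff (u : Grain d) (r : ℝ≥0) (y : EuclideanSpace ℝ (Fin d)) :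
    y ∈ u.grown r ↔ u.reachTime y ≤ r := by
  rw [mem_grown_iff_gauge, ← coe_reachTime, NNReal.coe_le_coe]

lemma continuous_reachTime (u : Grain d) : Continuous u.reachTime := by
  have : u.reachTime = fun y => (gauge u.shape.toSet (y - u.pos)).toNNReal :=
    funext u.reachTime_eq
  rw [this]
  exact continuous_real_toNNReal.comp
    ((continuous_gauge u.shape.convex u.shape.mem_nhds).comp (by fun_prop))

lemma reachTime_pos_iff (u : Grain d) (y : EuclideanSpace ℝ (Fin d)) :
    0 < u.reachTime y ↔ y ≠ u.pos := by
  rw [← NNReal.coe_pos, coe_reachTime, gauge_pos (absorbent_nhds_zero u.shape.mem_nhds)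
    (NormedSpace.isVonNBounded_of_isBounded ℝ u.shape.isCompact.isBounded), sub_ne_zero]

@[simp] lemma reachTime_pos_self (u : Grain d) : u.reachTime u.pos = 0 := by
  by_contra h
  exact (u.reachTime_pos_iff _).1 (pos_iff_ne_zero.2 h) rfl

lemma isCompact_grown (u : Grain d) (r : ℝ≥0) : IsCompact (u.grown r) :=
  u.shape.isCompact.image (by fun_prop)

/-- Moving `y` slightly towards the centre scales the gauge by a factor below 1. This is the means
of passing from weak to strict inequalities later. -/
lemma frequently_reachTime_lt (u : Grain d) {y : EuclideanSpace ℝ (Fin d)} (hy : y ≠ u.pos) :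
    ∃ᶠ z in 𝓝 y, u.reachTime z < u.reachTime y := by
  have hlim : Tendsto (fun c : ℝ => u.pos + c • (y - u.pos)) (𝓝[<] 1) (𝓝 y) := by
    have : Tendsto (fun c : ℝ => u.pos + c • (y - u.pos)) (𝓝 1)
        (𝓝 (u.pos + (1 : ℝ) • (y - u.pos))) := Continuous.tendsto (by fun_prop) _
    rw [one_smul, add_sub_cancel] at this
    exact this.mono_left nhdsWithin_le_nhds
  refine hlim.frequently (Eventually.frequently ?_)
  filter_upwards [Ioo_mem_nhdsLT (zero_lt_one' ℝ)] with c hc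
  have hpos := (u.reachTime_pos_iff y).2 hy
  rw [← NNReal.coe_pos] at hpos
  rw [← NNReal.coe_lt_coe, coe_reachTime, add_sub_cancel_left,
    gauge_smul_of_nonneg hc.1.le, ← coe_reachTime, smul_eq_mul]
  exact mul_lt_of_lt_one_left hpos hc.2

lemma mem_interior_grown_iff (hd : 0 < d) (u : Grain d) (r : ℝ≥0)
    (y : EuclideanSpace ℝ (Fin d)) :
    y ∈ interior (u.grown r) ↔ u.reachTime y < r := by
  constructor
  · intro h
    have hle := (u.mem_grown_iff r y).1 (interior_subset h)
    refine lt_of_le_of_ne hle fun heq => ?_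
    have hn := mem_interior_iff_mem_nhds.1 h
    rcases eq_or_ne y u.pos with rfl | hy
    · rw [reachTime_pos_self] at heq
      have : Nonempty (Fin d) := ⟨⟨0, hd⟩⟩
      have : Nontrivial (EuclideanSpace ℝ (Fin d)) := inferInstance
      -- For r = 0 the grown set is one point, whose interior is empty only in positive dimension.
      have : u.grown r ⊆ {u.pos} := by
        intro z hz
        rw [mem_grown_iff, ← heq] at hz
        by_contra hne
        exact (not_le.2 ((u.reachTime_pos_iff z).2 hne)) hz
      have h2 := interior_mono this h
      rw [interior_singleton] at h2
      exact h2
    · have hlim : Tendsto (fun c : ℝ => u.pos + c • (y - u.pos)) (𝓝[>] 1) (𝓝 y) := by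
        have : Tendsto (fun c : ℝ => u.pos + c • (y - u.pos)) (𝓝 1)
            (𝓝 (u.pos + (1 : ℝ) • (y - u.pos))) := Continuous.tendsto (by fun_prop) _
        rw [one_smul, add_sub_cancel] at this
        exact this.mono_left nhdsWithin_le_nhds
      obtain ⟨c, hc, hc1⟩ := ((hlim.eventually hn).and self_mem_nhdsWithin).exists
      have hc1 : (1 : ℝ) < c := hc1
      have hc' := (u.mem_grown_iff _ _).1 hc
      rw [← heq, ← NNReal.coe_le_coe, coe_reachTime, add_sub_cancel_left,
        gauge_smul_of_nonneg (by linarith), ← coe_reachTime, smul_eq_mul] at hc'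
      have hpos := (u.reachTime_pos_iff y).2 hy
      rw [← NNReal.coe_pos] at hpos
      nlinarith
  · intro h
    refine mem_interior.2 ⟨{z | u.reachTime z < r}, fun z hz => (u.mem_grown_iff r z).2 ?_,
      isOpen_lt u.continuous_reachTime continuous_const, h⟩
    exact le_of_lt hz

/-! ### Arrival, covering and meeting times. -/

/-- The time at which the freely growing grain reaches the point `y`. -/
def arrival (u : Grain d) (y : EuclideanSpace ℝ (Fin d)) : ℝ≥0 := u.birth + u.reachTime y

lemma continuous_arrival (u : Grain d) : Continuous u.arrival :=
  continuous_const.add u.continuous_reachTime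

@[simp] lemma arrival_pos (u : Grain d) : u.arrival u.pos = u.birth := by simp [arrival]

lemma birth_le_arrival (u : Grain d) (y : EuclideanSpace ℝ (Fin d)) :
    u.birth ≤ u.arrival y := le_self_add

lemma birth_lt_arrival (u : Grain d) {y : EuclideanSpace ℝ (Fin d)} (hy : y ≠ u.pos) :
    u.birth < u.arrival y :=
  lt_add_of_pos_right _ ((u.reachTime_pos_iff y).2 hy)

lemma frequently_arrival_lt (u : Grain d) {y : EuclideanSpace ℝ (Fin d)} (hy : y ≠ u.pos) :
    ∃ᶠ z in 𝓝 y, u.arrival z < u.arrival y :=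
  (u.frequently_reachTime_lt hy).mono fun _ hz => add_lt_add_right hz _

lemma isCompact_arrival_le (u : Grain d) (c : ℝ≥0) : IsCompact {y | u.arrival y ≤ c} :=
  (u.isCompact_grown c).of_isClosed_subset (isClosed_le u.continuous_arrival continuous_const)
    fun y hy => (u.mem_grown_iff c y).2 (le_trans le_add_self (show u.arrival y ≤ c from hy))

/-- The grain `u`, growing freely, covers the position of `v` when `v` is born. -/
def Covers (u v : Grain d) : Prop := u.arrival v.pos ≤ v.birth

/-- A grain reaches other positions strictly after its birth, so mutual covering at distinct
positions would make each birth strictly earlier than the other. -/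
lemma Covers.pos_eq {u v : Grain d} (h : u.Covers v) (h' : v.Covers u) : u.pos = v.pos := by
  by_contra hne
  have h1 := u.birth_lt_arrival (Ne.symm hne)
  have h2 := v.birth_lt_arrival hne
  exact absurd (h1.trans_le (h.trans (h2.le.trans h'))) (lt_irrefl _)

/-- The first time at which both freely growing grains have reached `y`. -/
def joint (u v : Grain d) (y : EuclideanSpace ℝ (Fin d)) : ℝ≥0 :=
  max (u.arrival y) (v.arrival y)

lemma continuous_joint (u v : Grain d) : Continuous (u.joint v) :=
  u.continuous_arrival.max v.continuous_arrival

lemma joint_comm (u v : Grain d) (y : EuclideanSpace ℝ (Fin d)) : u.joint v y = v.joint u y :=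
  max_comm _ _

/-- The time at which two freely growing grains meet. -/
def meetTime (u v : Grain d) : ℝ≥0 := ⨅ y, u.joint v y

lemma meetTime_le (u v : Grain d) (y : EuclideanSpace ℝ (Fin d)) :
    u.meetTime v ≤ u.joint v y :=
  ciInf_le (OrderBot.bddBelow _) y

/-- The sublevel sets of the arrival time are compact, so the continuous joint time attains its
minimum on closed sets. -/
lemma exists_forall_joint_le (u v : Grain d) {S : Set (EuclideanSpace ℝ (Fin d))}
    (hS : IsClosed S) (hne : S.Nonempty) : ∃ y ∈ S, ∀ z ∈ S, u.joint v y ≤ u.joint v z := by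
  obtain ⟨y₀, hy₀⟩ := hne
  have hK : IsCompact ({y | u.arrival y ≤ u.joint v y₀} ∩ S) :=
    (u.isCompact_arrival_le _).inter_right hS
  have hmem : y₀ ∈ {y | u.arrival y ≤ u.joint v y₀} ∩ S :=
    ⟨show u.arrival y₀ ≤ u.joint v y₀ from le_max_left _ _, hy₀⟩
  obtain ⟨y, hy, hmin⟩ := hK.exists_isMinOn ⟨y₀, hmem⟩
    (u.continuous_joint v).continuousOn
  refine ⟨y, hy.2, fun z hz => ?_⟩
  by_cases hz' : u.arrival z ≤ u.joint v y₀
  · exact hmin ⟨hz', hz⟩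
  · exact (hmin hmem).trans
      ((not_le.1 hz').le.trans (le_max_left _ _))

lemma exists_joint_eq_meetTime (u v : Grain d) : ∃ y, u.joint v y = u.meetTime v := by
  obtain ⟨y, -, hy⟩ := u.exists_forall_joint_le v isClosed_univ univ_nonempty
  exact ⟨y, le_antisymm (le_ciInf fun z => hy z (mem_univ z)) (u.meetTime_le v y)⟩

lemma meetTime_pos {u v : Grain d} (h : u.pos ≠ v.pos) : 0 < u.meetTime v := by
  obtain ⟨y, hy⟩ := u.exists_joint_eq_meetTime v
  rw [← hy]
  by_cases hu : y = u.pos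
  · have : y ≠ v.pos := hu ▸ h
    exact lt_max_of_lt_right ((zero_le (a := _)).trans_lt (v.birth_lt_arrival this))
  · exact lt_max_of_lt_left ((zero_le (a := _)).trans_lt (u.birth_lt_arrival hu))

/-- Unless `u` covers `v`, the grain `v` gets strictly closer to the meeting point before the two
grains meet. -/
lemma exists_arrival_lt_meetTime {u v : Grain d} (h : ¬ u.Covers v) {c : ℝ≥0}
    (hc : u.meetTime v < c) : ∃ y, v.arrival y < u.meetTime v ∧ u.joint v y < c := by
  obtain ⟨y, hy⟩ := u.exists_joint_eq_meetTime v
  by_cases hlt : v.arrival y < u.meetTime v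
  · exact ⟨y, hlt, hy ▸ hc⟩
  · have hle : v.arrival y ≤ u.meetTime v := hy ▸ le_max_right _ _
    have heq := le_antisymm hle (not_lt.1 hlt)
    -- Here `v` reaches the meeting point `y` exactly at the meeting time. Since `y` is not the
    -- centre of `v`, it can be moved towards that centre.
    have hne : y ≠ v.pos := by
      rintro rfl
      apply h
      have : u.arrival v.pos ≤ u.meetTime v := hy ▸ le_max_left _ _
      rwa [← heq, arrival_pos] at this
    have hev : ∀ᶠ z in 𝓝 y, u.joint v z < c :=
      (u.continuous_joint v).continuousAt.eventually_lt_const (hy ▸ hc)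
    obtain ⟨z, hz, hz'⟩ := ((v.frequently_arrival_lt hne).and_eventually hev).exists
    exact ⟨z, heq ▸ hz, hz'⟩

end Grain

/-! ### The antitone stopping operator and its iterates. -/

/-- If every grain `v` of `A` grows until the time `s v`, then the grain `u` is stopped at the time
`nextEnd A s u`. -/
def nextEnd (A : Set (Grain d)) (s : Grain d → ℝ≥0∞) (u : Grain d) : ℝ≥0∞ :=
  ⨅ (v : Grain d) (_ : v ∈ A ∧ v ≠ u ∧ ¬ u.Covers v) (y : EuclideanSpace ℝ (Fin d))
    (_ : (v.arrival y : ℝ≥0∞) < s v), (u.joint v y : ℝ≥0∞)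

lemma nextEnd_lt_iff {A : Set (Grain d)} {s : Grain d → ℝ≥0∞} {u : Grain d} {c : ℝ≥0∞} :
    nextEnd A s u < c ↔ ∃ v ∈ A, v ≠ u ∧ ¬ u.Covers v ∧
      ∃ y, (v.arrival y : ℝ≥0∞) < s v ∧ (u.joint v y : ℝ≥0∞) < c := by
  simp only [nextEnd, iInf_lt_iff, exists_prop, and_assoc]

lemma nextEnd_le {A : Set (Grain d)} {s : Grain d → ℝ≥0∞} {u v : Grain d} (hv : v ∈ A)
    (hvu : v ≠ u) (hc : ¬ u.Covers v) {y : EuclideanSpace ℝ (Fin d)}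
    (hy : (v.arrival y : ℝ≥0∞) < s v) : nextEnd A s u ≤ u.joint v y :=
  iInf₂_le_of_le v ⟨hv, hvu, hc⟩ (iInf₂_le y hy)

/-- Longer lives offer more stopping points to the infimum. Comparing on `A` alone matters, since an
arbitrary solution is controlled only there. -/
lemma nextEnd_le_of {A : Set (Grain d)} {s s' : Grain d → ℝ≥0∞} (h : ∀ v ∈ A, s v ≤ s' v)
    (u : Grain d) : nextEnd A s' u ≤ nextEnd A s u := by
  refine le_of_forall_gt fun c hc => ?_
  obtain ⟨v, hv, hvu, hcov, y, hy, hlt⟩ := nextEnd_lt_iff.1 hc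
  exact nextEnd_lt_iff.2 ⟨v, hv, hvu, hcov, y, hy.trans_le (h v hv), hlt⟩

lemma antitone_nextEnd (A : Set (Grain d)) : Antitone (nextEnd A) :=
  fun _ _ h u => nextEnd_le_of (fun v _ => h v) u

/-- Increasing lower bounds for the end times. -/
def endLower (A : Set (Grain d)) : ℕ → Grain d → ℝ≥0∞
  | 0 => fun _ => 0
  | n + 1 => nextEnd A (nextEnd A (endLower A n))

/-- Decreasing upper bounds for the end times. -/
def endUpper (A : Set (Grain d)) (n : ℕ) : Grain d → ℝ≥0∞ := nextEnd A (endLower A n)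

lemma endLower_succ (A : Set (Grain d)) (n : ℕ) :
    endLower A (n + 1) = nextEnd A (endUpper A n) := rfl

lemma monotone_endLower (A : Set (Grain d)) : Monotone (endLower A) := by
  refine monotone_nat_of_le_succ fun n => ?_
  induction n with
  | zero => exact fun _ => zero_le
  | succ n ih => exact antitone_nextEnd A (antitone_nextEnd A ih)

lemma antitone_endUpper (A : Set (Grain d)) : Antitone (endUpper A) :=
  fun _ _ h => antitone_nextEnd A (monotone_endLower A h)

/-- The even iterates of an antitone map from the bottom element stay below the odd ones: applying
the map twice preserves the inequality. -/
lemma endLower_le_endUpper_self (A : Set (Grain d)) (n : ℕ) : endLower A n ≤ endUpper A n := by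
  induction n with
  | zero => exact fun _ => zero_le
  | succ n ih =>
    have h : endLower A (n + 1) ≤ endUpper A n := antitone_nextEnd A ih
    exact antitone_nextEnd A h

lemma endLower_le_endUpper (A : Set (Grain d)) (m n : ℕ) : endLower A m ≤ endUpper A n :=
  (monotone_endLower A (le_max_left m n)).trans
    ((endLower_le_endUpper_self A _).trans (antitone_endUpper A (le_max_right m n)))

/-- The end times of the growth-maximal model. -/
def endTime (A : Set (Grain d)) (u : Grain d) : ℝ≥0∞ := ⨆ n, endLower A n u

lemma endLower_le_endTime (A : Set (Grain d)) (n : ℕ) : endLower A n ≤ endTime A :=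
  fun u => le_iSup (fun n => endLower A n u) n

lemma endTime_le_endUpper (A : Set (Grain d)) (n : ℕ) : endTime A ≤ endUpper A n :=
  fun u => iSup_le fun m => endLower_le_endUpper A m n u

/-! ### Convergence of the bounds under well-founded dependence. -/

/-- The pair `(v, s')` precedes `(u, s)` if the fate of `u` up to the time `s` depends on the fate
of `v` up to the time `s'` at which `u` and `v` meet. -/
def Precedes (A : Set (Grain d)) (p q : Grain d × ℝ≥0) : Prop :=
  p.1 ∈ A ∧ p.1 ≠ q.1 ∧ ¬ q.1.Covers p.1 ∧ p.2 = q.1.meetTime p.1 ∧ p.2 < q.2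

variable {A : Set (Grain d)}

/-- After finitely many iterations the fate of `u` up to time `s` is decided: either the bounds
agree or `u` is known to live until `s`. By induction this holds for the finitely many grains that
can stop `u` before `s`, each up to its meeting with `u`. -/
lemma exists_forall_endUpper_le_or (hwf : WellFounded (Precedes A))
    (hfin : ∀ u ∈ A, ∀ c, {v ∈ A | u.meetTime v ≤ c}.Finite) (p : Grain d × ℝ≥0) :
    p.1 ∈ A → ∃ n, ∀ m ≥ n, endUpper A m p.1 ≤ endLower A m p.1 ∨
      (p.2 : ℝ≥0∞) ≤ endLower A m p.1 := by
  induction p using hwf.induction with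
  | _ p ih =>
  obtain ⟨u, s⟩ := p
  intro hu
  have h1 : ∀ v : Grain d, ∃ n, v ∈ A → v ≠ u → ¬ u.Covers v → u.meetTime v < s →
      ∀ m ≥ n, endUpper A m v ≤ endLower A m v ∨ (u.meetTime v : ℝ≥0∞) ≤ endLower A m v := by
    intro v
    by_cases hv : v ∈ A ∧ v ≠ u ∧ ¬ u.Covers v ∧ u.meetTime v < s
    · obtain ⟨n, hn⟩ := ih (v, u.meetTime v) ⟨hv.1, hv.2.1, hv.2.2.1, rfl, hv.2.2.2⟩ hv.1
      exact ⟨n, fun _ _ _ _ => hn⟩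
    · exact ⟨0, fun a b c e => absurd ⟨a, b, c, e⟩ hv⟩
  choose N hN using h1
  obtain ⟨n, hn⟩ := ((hfin u hu s).image N).bddAbove
  refine ⟨n + 1, fun m hm => ?_⟩
  obtain ⟨m, rfl⟩ : ∃ k, m = k + 1 := ⟨m - 1, by omega⟩
  by_contra! hcon
  obtain ⟨hlt, hlts⟩ := hcon
  simp only at hlt hlts
  have hlt' : endLower A (m + 1) u < min (endUpper A m u) s :=
    lt_min (hlt.trans_le (antitone_endUpper A (Nat.le_succ m) u)) hlts
  rw [endLower_succ] at hlt'
  obtain ⟨v, hv, hvu, hcov, y, hy, hylt⟩ := nextEnd_lt_iff.1 hlt'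
  have hmeet : u.meetTime v < s := by
    have := hylt.trans_le (min_le_right _ _)
    exact (u.meetTime_le v y).trans_lt (by exact_mod_cast this)
  -- If `v` were certain to be alive at `z`, then `z` would lower the upper bound of `u`.
  have key : ∀ z, (u.joint v z : ℝ≥0∞) < endUpper A m u → endLower A m v ≤ v.arrival z := by
    intro z hz
    by_contra! h
    exact absurd (nextEnd_le hv hvu hcov h) (not_le.2 hz)
  have hset := hN v hv hvu hcov hmeet m
    ((hn ⟨v, ⟨hv, hmeet.le⟩, rfl⟩).trans (by omega))
  have hLU : endLower A m v < endUpper A m v :=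
    (key y (hylt.trans_le (min_le_left _ _))).trans_lt hy
  rcases hset with h | h
  · exact absurd hLU (not_lt.2 h)
  -- If `v` certainly lives until the meeting, a point that `v` reaches just before the meeting time
  -- contradicts `key`.
  · have hjoint : (u.meetTime v : ℝ≥0∞) < endUpper A m u :=
      lt_of_le_of_lt (by exact_mod_cast u.meetTime_le v y) (hylt.trans_le (min_le_left _ _))
    obtain ⟨c, hc1, hc2⟩ := ENNReal.lt_iff_exists_nnreal_btwn.1 hjoint
    obtain ⟨z, hz, hz'⟩ := Grain.exists_arrival_lt_meetTime hcov (ENNReal.coe_lt_coe.1 hc1)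
    have := key z (lt_trans (by exact_mod_cast hz') hc2)
    exact absurd (h.trans this) (not_le.2 (by exact_mod_cast hz))

lemma iInf_endUpper_le (hwf : WellFounded (Precedes A))
    (hfin : ∀ u ∈ A, ∀ c, {v ∈ A | u.meetTime v ≤ c}.Finite) {u : Grain d} (hu : u ∈ A) :
    ⨅ n, endUpper A n u ≤ endTime A u := by
  by_cases htop : endTime A u = ∞
  · rw [htop]; exact le_top
  -- Any horizon beyond `endTime A u` excludes the second alternative; one more unit of time is
  -- enough.
  · obtain ⟨n, hn⟩ := exists_forall_endUpper_le_or hwf hfin (u, (endTime A u).toNNReal + 1) hu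
    rcases hn n le_rfl with h | h
    · exact (iInf_le _ n).trans (h.trans (endLower_le_endTime A n u))
    · exfalso
      have h2 := h.trans (endLower_le_endTime A n u)
      simp only [ENNReal.coe_add, ENNReal.coe_toNNReal htop, ENNReal.coe_one] at h2
      exact absurd h2 (not_le.2 (ENNReal.lt_add_right htop one_ne_zero))

lemma endTime_eq_nextEnd (hwf : WellFounded (Precedes A))
    (hfin : ∀ u ∈ A, ∀ c, {v ∈ A | u.meetTime v ≤ c}.Finite) {u : Grain d} (hu : u ∈ A) :
    endTime A u = nextEnd A (endTime A) u := by
  apply le_antisymm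
  · refine iSup_le fun n => (monotone_endLower A (Nat.le_succ n) u).trans ?_
    exact antitone_nextEnd A (endTime_le_endUpper A n) u
  · refine le_trans (le_iInf fun n => ?_) (iInf_endUpper_le hwf hfin hu)
    exact antitone_nextEnd A (endLower_le_endTime A n) u

/-- Induction puts any solution above all lower bounds, hence below all upper bounds, and these have
the same limit. -/
lemma eq_endTime_of_eq_nextEnd (hwf : WellFounded (Precedes A))
    (hfin : ∀ u ∈ A, ∀ c, {v ∈ A | u.meetTime v ≤ c}.Finite) {s : Grain d → ℝ≥0∞}
    (hs : ∀ u ∈ A, s u = nextEnd A s u) {u : Grain d} (hu : u ∈ A) : s u = endTime A u := by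
  have h : ∀ n, ∀ u ∈ A, endLower A n u ≤ s u := by
    intro n
    induction n with
    | zero => exact fun _ _ => zero_le
    | succ n ih =>
      intro u hu
      rw [hs u hu]
      refine nextEnd_le_of (fun v hv => ?_) u
      rw [hs v hv]
      exact nextEnd_le_of ih v
  refine le_antisymm (le_trans (le_iInf fun n => ?_) (iInf_endUpper_le hwf hfin hu))
    (iSup_le fun n => h n u hu)
  rw [hs u hu]
  exact nextEnd_le_of (h n) u

/-! ### Finiteness of the end times. -/

/-- In an infinite configuration, all grains stop growing. -/
lemma endTime_ne_top (hinf : A.Infinite) (hpos : ∀ u ∈ A, ∀ v ∈ A, u ≠ v → u.pos ≠ v.pos)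
    (hcov : ∀ u ∈ A, {v ∈ A | u.Covers v}.Finite) {s : Grain d → ℝ≥0∞}
    (hs : ∀ u ∈ A, s u = nextEnd A s u) {u : Grain d} (hu : u ∈ A) : s u ≠ ∞ := by
  intro htop
  -- A grain covered by the immortal `u` is stopped at its birth; one that is not covered would stop
  -- `u` if it ever grew.
  have dead : ∀ v ∈ A, v ≠ u → s v ≤ v.birth := by
    intro v hv hvu
    by_cases hc : u.Covers v
    · have hc' : ¬ v.Covers u := fun h => hpos u hu v hv hvu.symm (hc.pos_eq h)
      rw [hs v hv]
      refine (nextEnd_le hu hvu.symm hc' (y := v.pos) (by rw [htop]; exact ENNReal.coe_lt_top)).trans ?_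
      rw [Grain.joint, Grain.arrival_pos, max_eq_left hc]
    · by_contra! hlt
      rw [← Grain.arrival_pos] at hlt
      have := nextEnd_le hv hvu hc hlt
      rw [← hs u hu, htop] at this
      exact absurd this (not_le.2 ENNReal.coe_lt_top)
  -- Dead grains stop nothing, so only `u` can have stopped `v` at its birth, which means that `u`
  -- covers `v`.
  have hall : A ⊆ insert u {v ∈ A | u.Covers v} := by
    intro v hv
    rcases eq_or_ne v u with h | hvu
    · exact Or.inl h
    refine Or.inr ⟨hv, ?_⟩
    have hle : v.meetTime u ≤ v.birth := by
      refine le_of_forall_gt fun c hc => ?_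
      have h1 : nextEnd A s v < c := by
        rw [← hs v hv]
        exact (dead v hv hvu).trans_lt (by exact_mod_cast hc)
      obtain ⟨w, hw, hwv, -, y, hy, hlt⟩ := nextEnd_lt_iff.1 h1
      have hwu : w = u := by
        by_contra hwu
        have h2 := hy.trans_le (dead w hw hwu)
        exact absurd (w.birth_le_arrival y) (not_le.2 (by exact_mod_cast h2))
      subst hwu
      exact (v.meetTime_le w y).trans_lt (by exact_mod_cast hlt)
    obtain ⟨y, hy⟩ := v.exists_joint_eq_meetTime u
    have h1 : v.arrival y ≤ v.birth := (le_max_left _ _).trans (hy.le.trans hle)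
    have h2 : u.arrival y ≤ v.birth := (le_max_right _ _).trans (hy.le.trans hle)
    have h3 : y = v.pos := by
      by_contra hne
      exact absurd (v.birth_lt_arrival hne) (not_lt.2 h1)
    rw [h3] at h2
    exact h2
  exact hinf (((hcov u hu).insert u).subset hall)

/-! ### Growth-maximality as a fixed point equation. -/

/-- A grain which reaches `y` in its life time covers points close to `y` in its life time. -/
lemma Grain.exists_joint_lt {u v : Grain d} {y : EuclideanSpace ℝ (Fin d)} {s c : ℝ≥0}
    (hv : v.birth < s) (hy : v.arrival y ≤ s) (hc : u.joint v y < c) :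
    ∃ z, v.arrival z < s ∧ u.joint v z < c := by
  rcases hy.lt_or_eq with hlt | heq
  · exact ⟨y, hlt, hc⟩
  · have hne : y ≠ v.pos := by
      rintro rfl
      rw [Grain.arrival_pos] at heq
      exact hv.ne heq
    have hev : ∀ᶠ z in 𝓝 y, u.joint v z < c :=
      (u.continuous_joint v).continuousAt.eventually_lt_const hc
    obtain ⟨z, hz, hz'⟩ := ((v.frequently_arrival_lt hne).and_eventually hev).exists
    exact ⟨z, heq ▸ hz, hz'⟩

lemma nextEnd_le_joint {s : Grain d → ℝ≥0∞} {u v : Grain d} {t : ℝ≥0} (hv : v ∈ A)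
    (hvu : v ≠ u) (hc : ¬ u.Covers v) (ht : s v = t) (hb : v.birth < t)
    {y : EuclideanSpace ℝ (Fin d)} (hy : v.arrival y ≤ t) : nextEnd A s u ≤ u.joint v y := by
  refine le_of_forall_gt fun c hc' => ?_
  obtain ⟨e, he1, he2⟩ := ENNReal.lt_iff_exists_nnreal_btwn.1 hc'
  obtain ⟨z, hz, hz'⟩ := Grain.exists_joint_lt hb hy (ENNReal.coe_lt_coe.1 he1)
  refine (nextEnd_le hv hvu hc (y := z) (by rw [ht]; exact_mod_cast hz)).trans_lt ?_
  exact lt_trans (by exact_mod_cast hz') he2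

/-- The infimum in `nextEnd` is attained once the strict condition on `y` is relaxed to a weak one:
each grain has a minimizing point, and only finitely many grains compete just above `t`. -/
lemma exists_joint_le_of_nextEnd_eq {s : Grain d → ℝ≥0∞} {u : Grain d} {t : ℝ≥0}
    (hfin : ∀ c, {v ∈ A | u.meetTime v ≤ c}.Finite) (h : nextEnd A s u = t) :
    ∃ v ∈ A, v ≠ u ∧ ¬ u.Covers v ∧ (v.birth : ℝ≥0∞) < s v ∧
      ∃ y, (v.arrival y : ℝ≥0∞) ≤ s v ∧ u.joint v y ≤ t := by
  by_contra! hcon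
  set F := {v ∈ A | u.meetTime v ≤ t + 1}
  have h1 : ∀ v : Grain d, ∃ e : ℝ≥0, t < e ∧ (v ∈ A → v ≠ u → ¬ u.Covers v →
      ∀ y, (v.arrival y : ℝ≥0∞) < s v → e ≤ u.joint v y) := by
    intro v
    by_cases hv : v ∈ A ∧ v ≠ u ∧ ¬ u.Covers v ∧ (v.birth : ℝ≥0∞) < s v
    · have hcl : IsClosed {y | (v.arrival y : ℝ≥0∞) ≤ s v} :=
        isClosed_le (ENNReal.continuous_coe.comp v.continuous_arrival) continuous_const
      have hne : {y | (v.arrival y : ℝ≥0∞) ≤ s v}.Nonempty := by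
        refine ⟨v.pos, ?_⟩
        change (v.arrival v.pos : ℝ≥0∞) ≤ s v
        rw [Grain.arrival_pos]
        exact hv.2.2.2.le
      obtain ⟨y, hy, hmin⟩ := u.exists_forall_joint_le v hcl hne
      exact ⟨_, hcon v hv.1 hv.2.1 hv.2.2.1 hv.2.2.2 y hy, fun _ _ _ z hz => hmin z hz.le⟩
    · refine ⟨t + 1, lt_add_one t, fun h1 h2 h3 y hy => absurd ⟨h1, h2, h3, ?_⟩ hv⟩
      exact lt_of_le_of_lt (by exact_mod_cast v.birth_le_arrival y) hy
  choose e he hle using h1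
  obtain ⟨c, hc1, hc2⟩ : ∃ c : ℝ≥0, t < c ∧ ∀ v ∈ F, c ≤ min (e v) (t + 1) := by
    by_cases hF : F.Nonempty
    · obtain ⟨v, -, hv⟩ := Set.exists_min_image F (fun v => min (e v) (t + 1)) (hfin _) hF
      exact ⟨_, lt_min (he v) (lt_add_one t), hv⟩
    · exact ⟨t + 1, lt_add_one t, fun v hv => absurd ⟨v, hv⟩ hF⟩
  have hlt : nextEnd A s u < (min c (t + 1) : ℝ≥0) := by
    rw [h]
    exact_mod_cast lt_min hc1 (lt_add_one t)
  obtain ⟨v, hv, hvu, hcov, y, hy, hylt⟩ := nextEnd_lt_iff.1 hlt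
  have hylt : u.joint v y < min c (t + 1) := by exact_mod_cast hylt
  have hvF : v ∈ F := ⟨hv, (u.meetTime_le v y).trans (hylt.le.trans (min_le_right _ _))⟩
  have := ((hc2 v hvF).trans (min_le_left _ _)).trans (hle v hv hvu hcov y hy)
  exact absurd (hylt.trans_le (min_le_left _ _)) (not_lt.2 this)

lemma Grain.reachTime_le_iff (u : Grain d) (y : EuclideanSpace ℝ (Fin d)) (r : ℝ≥0) :
    u.reachTime y ≤ r ↔ u.arrival y ≤ u.birth + r := by
  rw [Grain.arrival, add_le_add_iff_left]

lemma Grain.reachTime_lt_iff (u : Grain d) (y : EuclideanSpace ℝ (Fin d)) (r : ℝ≥0) :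
    u.reachTime y < r ↔ u.arrival y < u.birth + r := by
  rw [Grain.arrival, add_lt_add_iff_left]

/-- The end times of a growth-maximal model solve the fixed point equation. -/
lemma IsGrowthMaximal.eq_nextEnd (hd : 0 < d)
    (hpos : ∀ u ∈ A, ∀ v ∈ A, u ≠ v → u.pos ≠ v.pos) {r : A → ℝ≥0}
    (h : IsGrowthMaximal (fun u : A => (u : Grain d)) r) {s : Grain d → ℝ≥0∞}
    (hs : ∀ u : A, s u = ((u : Grain d).birth + r u : ℝ≥0)) : ∀ u ∈ A, s u = nextEnd A s u := by
  have hdisj : ∀ u v : A, u ≠ v → ∀ y, (u : Grain d).arrival y < (u : Grain d).birth + r u →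
      (v : Grain d).arrival y < (v : Grain d).birth + r v → False := by
    intro u v huv y hu hv
    refine Set.disjoint_left.1 (h.hardCore u v huv)
      ((Grain.mem_interior_grown_iff hd _ _ y).2 ?_) ((Grain.mem_interior_grown_iff hd _ _ y).2 ?_)
    · rwa [Grain.reachTime_lt_iff]
    · rwa [Grain.reachTime_lt_iff]
  intro u hu
  apply le_antisymm
  · refine le_of_forall_gt fun c hc => ?_
    obtain ⟨v, hv, hvu, hcov, y, hy, hlt⟩ := nextEnd_lt_iff.1 hc
    refine lt_of_le_of_lt ?_ hlt
    rw [hs ⟨u, hu⟩]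
    rw [hs ⟨v, hv⟩] at hy
    by_contra! hcon
    have hcon : u.joint v y < u.birth + r ⟨u, hu⟩ := by exact_mod_cast hcon
    exact hdisj ⟨u, hu⟩ ⟨v, hv⟩ (fun he => hvu (congrArg Subtype.val he).symm) y
      ((le_max_left _ _).trans_lt hcon) (by exact_mod_cast hy)
  -- The grain supplied by (ii) or (iii) is an admissible competitor in the infimum.
  · have key : ∀ v : A, v ≠ ⟨u, hu⟩ → ¬ u.Covers v → 0 < r v →
        ∀ y, (v : Grain d).arrival y ≤ (v : Grain d).birth + r v →
        u.joint v y ≤ u.birth + r ⟨u, hu⟩ → nextEnd A s u ≤ s u := by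
      intro v hvu hcov hr y hy hj
      refine (nextEnd_le_joint v.2 (fun he => hvu (Subtype.ext he)) hcov (hs v)
        (lt_add_of_pos_right _ hr) hy).trans ?_
      rw [hs ⟨u, hu⟩]
      exact_mod_cast hj
    rcases eq_zero_or_pos (r ⟨u, hu⟩) with h0 | h0
    · obtain ⟨v, hvu, hr, hmem, hle⟩ := h.earlier_of_zero _ h0
      have hcv : (v : Grain d).Covers u := hle
      have hmem := (Grain.mem_grown_iff _ _ _).1 hmem
      rw [Grain.reachTime_le_iff] at hmem
      refine key v hvu (fun hc => ?_) hr u.pos hmem ?_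
      · exact hpos u hu v v.2 (fun he => hvu (Subtype.ext he.symm)) (hc.pos_eq hcv)
      · rw [Grain.joint, Grain.arrival_pos, max_eq_left hcv]
        exact le_self_add
    · obtain ⟨v, hvu, hr, hle, y, hyu, hyv⟩ := h.earlier_of_pos _ h0
      simp only [Grain.mem_grown_iff, Grain.reachTime_le_iff] at hyu hyv
      refine key v hvu (fun hc => ?_) hr y hyv (max_le hyu (hyv.trans hle))
      -- If `u` covered its stopper `v`, the centre of `v` would be interior to both full-grown
      -- grains.
      have h1 : (v : Grain d).birth < (v : Grain d).birth + r v := lt_add_of_pos_right _ hr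
      exact hdisj v ⟨u, hu⟩ hvu (v : Grain d).pos (by rwa [Grain.arrival_pos])
        ((hc.trans_lt h1).trans_le hle)

/-- The solutions of the fixed point equation are growth-maximal. -/
lemma isGrowthMaximal_of_eq_nextEnd (hd : 0 < d)
    (hpos : ∀ u ∈ A, ∀ v ∈ A, u ≠ v → u.pos ≠ v.pos)
    (hfin : ∀ u ∈ A, ∀ c, {v ∈ A | u.meetTime v ≤ c}.Finite) {r : A → ℝ≥0}
    {s : Grain d → ℝ≥0∞} (hs : ∀ u : A, s u = ((u : Grain d).birth + r u : ℝ≥0))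
    (h : ∀ u ∈ A, s u = nextEnd A s u) : IsGrowthMaximal (fun u : A => (u : Grain d)) r := by
  have hle : ∀ u v : A, v ≠ u → ¬ (u : Grain d).Covers v → ∀ y,
      (v : Grain d).arrival y < (v : Grain d).birth + r v →
      (u : Grain d).birth + r u ≤ (u : Grain d).joint v y := by
    intro u v hvu hcov y hy
    have := nextEnd_le v.2 (fun he => hvu (Subtype.ext he)) hcov (s := s) (y := y)
      (by rw [hs v]; exact_mod_cast hy)
    rw [← h u u.2, hs u] at this
    exact_mod_cast this
  have hasymm : ∀ u v : A, v ≠ u → (u : Grain d).Covers v → ¬ (v : Grain d).Covers u :=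
    fun u v hvu hc hc' => hpos u u.2 v v.2 (fun he => hvu (Subtype.ext he.symm)) (hc.pos_eq hc')
  -- The equation for `v` makes `u` outlive `v`. Then `u` is alive when it reaches the centre of
  -- `v`, which stops `v` at its birth.
  have hcovers : ∀ u v : A, v ≠ u → (u : Grain d).Covers v → ∀ y,
      (u : Grain d).arrival y < (u : Grain d).birth + r u →
      (v : Grain d).arrival y < (v : Grain d).birth + r v → False := by
    intro u v hvu hc y hu hv
    have hnc := hasymm u v hvu hc
    have h1 := hle v u hvu.symm hnc y hu
    rw [Grain.joint, le_max_iff] at h1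
    have h2 := h1.resolve_left (not_le.2 hv)
    have h3 : (v : Grain d).birth < (v : Grain d).birth + r v :=
      ((v : Grain d).birth_le_arrival y).trans_lt hv
    have h4 : (u : Grain d).arrival (v : Grain d).pos < (u : Grain d).birth + r u :=
      (hc.trans_lt h3).trans (h2.trans_lt hu)
    have h5 := hle v u hvu.symm hnc _ h4
    rw [Grain.joint, Grain.arrival_pos, max_eq_left hc] at h5
    exact absurd h3 (not_lt.2 h5)
  have hdisj : ∀ u v : A, u ≠ v → ∀ y,
      (u : Grain d).arrival y < (u : Grain d).birth + r u →
      (v : Grain d).arrival y < (v : Grain d).birth + r v → False := by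
    intro u v huv y hu hv
    by_cases hc : (u : Grain d).Covers v
    · exact hcovers u v huv.symm hc y hu hv
    by_cases hc' : (v : Grain d).Covers u
    · exact hcovers v u huv hc' y hv hu
    -- Without covering, each grain ends no later than the other arrives at `y`; these inequalities
    -- form a strict cycle.
    have h1 := (le_max_iff.1 (hle u v huv.symm hc y hv)).resolve_left (not_le.2 hu)
    have h2 := (le_max_iff.1 (hle v u huv hc' y hu)).resolve_left (not_le.2 hv)
    exact absurd (h1.trans_lt hv) (not_lt.2 (h2.trans hu.le))
  have hblock : ∀ u : A, ∃ v : A, v ≠ u ∧ ¬ (u : Grain d).Covers v ∧ 0 < r v ∧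
      ∃ y, (v : Grain d).arrival y ≤ (v : Grain d).birth + r v ∧
        (u : Grain d).joint v y ≤ (u : Grain d).birth + r u := by
    intro u
    obtain ⟨v, hv, hvu, hcov, hb, y, hy, hj⟩ :=
      exists_joint_le_of_nextEnd_eq (hfin u u.2) ((h u u.2).symm.trans (hs u))
    rw [hs ⟨v, hv⟩] at hb hy
    refine ⟨⟨v, hv⟩, fun he => hvu (congrArg Subtype.val he), hcov, ?_, y, by exact_mod_cast hy, hj⟩
    exact pos_of_lt_add_right (by exact_mod_cast hb : v.birth < v.birth + r ⟨v, hv⟩)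
  refine ⟨fun u v huv => ?_, fun u hu => ?_, fun u hu => ?_⟩
  · refine Set.disjoint_left.2 fun y hyu hyv => ?_
    rw [Grain.mem_interior_grown_iff hd, Grain.reachTime_lt_iff] at hyu hyv
    exact hdisj u v huv y hyu hyv
  · obtain ⟨v, hvu, -, hr, y, hy, hj⟩ := hblock u
    rw [hu, add_zero] at hj
    have hyu : y = (u : Grain d).pos := by
      by_contra hne
      exact absurd ((u : Grain d).birth_lt_arrival hne) (not_lt.2 ((le_max_left _ _).trans hj))
    subst hyu
    refine ⟨v, hvu, hr, ?_, (le_max_right _ _).trans hj⟩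
    rwa [Grain.mem_grown_iff, Grain.reachTime_le_iff]
  · obtain ⟨v, hvu, hcov, hr, y, hy, hj⟩ := hblock u
    have hju := (le_max_left _ _).trans hj
    have hjv := (le_max_right _ _).trans hj
    refine ⟨v, hvu, hr, ?_, y, ?_, ?_⟩
    -- If the stopper `v` outlived `u`, then `u` would stop `v` earlier, or `v` would have covered
    -- `u` at its birth.
    · by_contra! hlt
      have hub : (u : Grain d).birth < (u : Grain d).birth + r u := lt_add_of_pos_right _ hu
      by_cases hc : (v : Grain d).Covers u
      · have h1 := hle u v hvu hcov (u : Grain d).pos (hc.trans_lt (hub.trans hlt))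
        rw [Grain.joint, Grain.arrival_pos, max_eq_left hc] at h1
        exact absurd hub (not_lt.2 h1)
      · obtain ⟨z, hz, hz'⟩ := Grain.exists_joint_lt (u := (v : Grain d)) hub hju
          (Grain.joint_comm _ _ y ▸ hj.trans_lt hlt)
        exact absurd (hle v u hvu.symm hc z hz) (not_le.2 hz')
    · rwa [Grain.mem_grown_iff, Grain.reachTime_le_iff]
    · rwa [Grain.mem_grown_iff, Grain.reachTime_le_iff]


/-! ### From descending chains to injective paths in a time window. -/

/-- The freely growing grains `u` and `v` meet in the time interval `(a, b]`, and the meeting may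
stop `u`. -/
def WindowEdge (a b : ℝ≥0) (u v : Grain d) : Prop :=
  a < u.meetTime v ∧ u.meetTime v ≤ b ∧ ¬ u.Covers v

/-- Loop erasure: a walk that visits every point finitely often has an injective subwalk. -/
lemma exists_injective_of_finite_visits {α : Type*} {E : α → α → Prop} {w : ℕ → α}
    (hE : ∀ n, E (w n) (w (n + 1))) (hfin : ∀ n, {m | w m = w n}.Finite) :
    ∃ k : ℕ → ℕ, Function.Injective (w ∘ k) ∧ ∀ i, E (w (k i)) (w (k (i + 1))) := by
  -- From each visited point jump to its last visit, then take one step; no point is then visited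
  -- again.
  have hlast : ∀ n, ∃ l, n ≤ l ∧ w l = w n ∧ ∀ m, l < m → w m ≠ w n := by
    intro n
    obtain ⟨l, hl, hmax⟩ := Set.exists_max_image _ id (hfin n) ⟨n, rfl⟩
    exact ⟨l, hmax n rfl, hl, fun m hm h => absurd (hmax m h) (not_le.2 hm)⟩
  choose l hle hl hmax using hlast
  let k : ℕ → ℕ := fun i => Nat.rec (l 0) (fun _ m => l (m + 1)) i
  have hk : ∀ i, k (i + 1) = l (k i + 1) := fun _ => rfl
  have hmono : StrictMono k := strictMono_nat_of_lt_succ fun i => by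
    rw [hk]; exact hle (k i + 1)
  have hkl : ∀ i, ∃ n, k i = l n := by
    rintro (_ | i)
    exacts [⟨0, rfl⟩, ⟨k i + 1, rfl⟩]
  have hne : ∀ i m, k i < m → w m ≠ w (k i) := by
    intro i m him
    obtain ⟨n, hn⟩ := hkl i
    rw [hn, hl]
    exact hmax n m (hn ▸ him)
  refine ⟨k, fun i j hij => ?_, fun i => ?_⟩
  · by_contra h
    rcases lt_or_gt_of_ne h with h | h
    · exact hne i _ (hmono h) hij.symm
    · exact hne j _ (hmono h) hij
  · rw [hk, hl]
    exact hE _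

lemma wellFounded_precedes (hpos : ∀ u ∈ A, ∀ v ∈ A, u ≠ v → u.pos ≠ v.pos)
    (hfin : ∀ u ∈ A, ∀ c, {v ∈ A | u.meetTime v ≤ c}.Finite)
    (hpath : ∀ M : ℕ, ∃ ε : ℝ≥0, 0 < ε ∧ ∀ j : ℕ, j * ε ≤ M → ¬ ∃ p : ℕ → Grain d,
      Function.Injective p ∧ (∀ i, p i ∈ A) ∧
        ∀ i, WindowEdge (j * ε) ((j + 1) * ε) (p i) (p (i + 1))) :
    WellFounded (Precedes A) := by
  rw [wellFounded_iff_isEmpty_descending_chain]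
  refine ⟨fun ⟨q, hq⟩ => ?_⟩
  -- The shift drops the start of the chain, which need not lie in `A`.
  set w : ℕ → Grain d := fun n => (q (n + 1)).1
  set f : ℕ → ℝ≥0 := fun n => (w n).meetTime (w (n + 1))
  have hwA : ∀ n, w n ∈ A := fun n => (hq n).1
  have hwne : ∀ n, w (n + 1) ≠ w n := fun n => (hq (n + 1)).2.1
  have hwc : ∀ n, ¬ (w n).Covers (w (n + 1)) := fun n => (hq (n + 1)).2.2.1
  have hqf : ∀ n, (q (n + 2)).2 = f n := fun n => (hq (n + 1)).2.2.2.1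
  have hf : StrictAnti f := strictAnti_nat_of_succ_lt fun n => by
    rw [← hqf n, ← hqf (n + 1)]
    exact (hq (n + 2)).2.2.2.2
  obtain ⟨M, hM⟩ := exists_nat_ge (f 0)
  obtain ⟨ε, hε, hno⟩ := hpath M
  -- The window index of the meeting time decreases, so it is eventually constant; it is positive
  -- because distinct positions meet at positive times.
  set J : ℕ → ℕ := fun n => ⌈f n / ε⌉₊
  have hJ : Antitone J := fun m n hmn => Nat.ceil_mono (by gcongr; exact hf.antitone hmn)
  obtain ⟨N, hN⟩ : ∃ N, ∀ n, J N ≤ J n :=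
    ⟨_, fun n => Function.argmin_le J n⟩
  have hJN : ∀ n, J (N + n) = J N := fun n => le_antisymm (hJ (Nat.le_add_right N n)) (hN _)
  have hJ0 : 0 < J N := Nat.ceil_pos.2 (div_pos (Grain.meetTime_pos
    (hpos _ (hwA N) _ (hwA (N + 1)) (hwne N).symm)) hε)
  obtain ⟨j, hj⟩ : ∃ j, J N = j + 1 := ⟨J N - 1, by omega⟩
  have hedge : ∀ n, WindowEdge (j * ε) ((j + 1) * ε) (w (N + n)) (w (N + n + 1)) := by
    intro n
    have h1 : J (N + n) = j + 1 := (hJN n).trans hj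
    refine ⟨?_, ?_, hwc _⟩
    · have : (j : ℝ≥0) < f (N + n) / ε := Nat.lt_ceil.1 (by change j < J (N + n); omega)
      rwa [lt_div_iff₀ hε] at this
    · have : f (N + n) / ε ≤ ((j + 1 : ℕ) : ℝ≥0) := Nat.ceil_le.1 h1.le
      rw [div_le_iff₀ hε] at this
      exact_mod_cast this
  obtain ⟨k, hk, hke⟩ := exists_injective_of_finite_visits (w := fun n => w (N + n)) hedge (by
    intro n
    -- Two visits to the same grain have different successors, because the meeting times are
    -- distinct, and the successors lie in a finite set.
    refine Set.Finite.of_finite_image (f := fun m => w (N + m + 1))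
      ((hfin _ (hwA (N + n)) (f 0)).subset ?_) ?_
    · rintro _ ⟨m, hm, rfl⟩
      refine ⟨hwA _, ?_⟩
      change (w (N + n)).meetTime (w (N + m + 1)) ≤ f 0
      have hm : w (N + m) = w (N + n) := hm
      rw [← hm]
      exact hf.antitone (Nat.zero_le (N + m))
    · intro m hm m' hm' he
      have hm : w (N + m) = w (N + n) := hm
      have hm' : w (N + m') = w (N + n) := hm'
      have he : w (N + m + 1) = w (N + m' + 1) := he
      have : f (N + m) = f (N + m') := by
        simp only [f]
        rw [he, hm, hm']
      have := hf.injective this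
      omega)
  refine hno j ?_ ⟨_, hk, fun i => hwA _, hke⟩
  exact ((hedge 0).1.le.trans (hf.antitone (Nat.zero_le _))).trans hM

/-! ### Topology of shapes and measurability of growth functionals. -/

/-- A shape as a nonempty compact set. -/
def Shape.toNonemptyCompacts (K : Shape d) : NonemptyCompacts (EuclideanSpace ℝ (Fin d)) :=
  ⟨⟨K.toSet, K.isCompact⟩, ⟨0, K.zero_mem⟩⟩

lemma Shape.isEmbedding_toNonemptyCompacts :
    IsEmbedding (Shape.toNonemptyCompacts (d := d)) := by
  have h : Isometry (fun K : ConvexBody (EuclideanSpace ℝ (Fin d)) =>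
      (⟨⟨K, K.isCompact⟩, K.nonempty⟩ : NonemptyCompacts (EuclideanSpace ℝ (Fin d)))) := by
    intro K L
    rw [← ConvexBody.hausdorffEDist_coe]
    rfl
  exact h.isEmbedding.comp IsEmbedding.subtypeVal

instance : SecondCountableTopology (Shape d) :=
  Shape.isEmbedding_toNonemptyCompacts.secondCountableTopology

instance : T2Space (Shape d) := Shape.isEmbedding_toNonemptyCompacts.t2Space

/-- The distance to a closed set is jointly continuous in the point and the set, and membership is
its zero set. -/
lemma Shape.isClosed_mem : IsClosed {p : EuclideanSpace ℝ (Fin d) × Shape d | p.1 ∈ p.2.toSet} := by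
  have h : {p : EuclideanSpace ℝ (Fin d) × Shape d | p.1 ∈ p.2.toSet} =
      (fun p : EuclideanSpace ℝ (Fin d) × Shape d =>
        infEDist p.1 (NonemptyCompacts.toCloseds p.2.toNonemptyCompacts :
          Set (EuclideanSpace ℝ (Fin d)))) ⁻¹' {0} := by
    ext p
    exact mem_iff_infEDist_zero_of_closed p.2.isCompact.isClosed
  rw [h]
  refine IsClosed.preimage (Closeds.continuous_infEDist.comp (continuous_fst.prodMk ?_))
    isClosed_singleton
  exact NonemptyCompacts.isometry_toCloseds.continuous.comp
    (Shape.isEmbedding_toNonemptyCompacts.continuous.comp continuous_snd)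

namespace Grain

@[fun_prop] lemma measurable_pos : Measurable (Grain.pos (d := d)) := measurable_fst
@[fun_prop] lemma measurable_birth : Measurable (Grain.birth (d := d)) :=
  measurable_fst.comp measurable_snd
@[fun_prop] lemma measurable_shape : Measurable (Grain.shape (d := d)) :=
  measurable_snd.comp measurable_snd

lemma measurable_uncurry_reachTime :
    Measurable fun p : Grain d × EuclideanSpace ℝ (Fin d) => p.1.reachTime p.2 := by
  refine measurable_of_Iic fun r => ?_
  rcases eq_zero_or_pos r with rfl | hr
  · have : (fun p : Grain d × EuclideanSpace ℝ (Fin d) => p.1.reachTime p.2) ⁻¹' Iic 0 =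
        {p | p.2 = p.1.pos} := by
      ext p
      rw [mem_preimage, mem_Iic, ← not_lt, Grain.reachTime_pos_iff, not_not]
      rfl
    rw [this]
    exact measurableSet_eq_fun measurable_snd (measurable_pos.comp measurable_fst)
  · have : (fun p : Grain d × EuclideanSpace ℝ (Fin d) => p.1.reachTime p.2) ⁻¹' Iic r =
        (fun p : Grain d × EuclideanSpace ℝ (Fin d) =>
          ((r : ℝ)⁻¹ • (p.2 - p.1.pos), p.1.shape)) ⁻¹' {p | p.1 ∈ p.2.toSet} := by
      ext p
      rw [mem_preimage, mem_Iic, ← mem_grown_iff]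
      have hr' : (r : ℝ) ≠ 0 := by exact_mod_cast hr.ne'
      constructor
      · rintro ⟨z, hz, h⟩
        change (r : ℝ)⁻¹ • (p.2 - p.1.pos) ∈ p.1.shape.toSet
        rw [← h, add_sub_cancel_left, smul_smul, inv_mul_cancel₀ hr', one_smul]
        exact hz
      · intro h
        refine ⟨_, h, ?_⟩
        simp only [smul_smul, mul_inv_cancel₀ hr', one_smul, add_sub_cancel]
    rw [this]
    exact measurableSet_preimage (by fun_prop) Shape.isClosed_mem.measurableSet

@[fun_prop] lemma _root_.Measurable.reachTime {α : Type*} [MeasurableSpace α] {f : α → Grain d}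
    {g : α → EuclideanSpace ℝ (Fin d)} (hf : Measurable f) (hg : Measurable g) :
    Measurable fun a => (f a).reachTime (g a) := by
  have h := measurable_uncurry_reachTime.comp (hf.prodMk hg)
  exact h

@[fun_prop] lemma _root_.Measurable.arrival {α : Type*} [MeasurableSpace α] {f : α → Grain d}
    {g : α → EuclideanSpace ℝ (Fin d)} (hf : Measurable f) (hg : Measurable g) :
    Measurable fun a => (f a).arrival (g a) := by
  unfold Grain.arrival
  fun_prop

@[fun_prop] lemma _root_.Measurable.joint {α : Type*} [MeasurableSpace α] {f f' : α → Grain d}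
    {g : α → EuclideanSpace ℝ (Fin d)} (hf : Measurable f) (hf' : Measurable f')
    (hg : Measurable g) : Measurable fun a => (f a).joint (f' a) (g a) := by
  unfold Grain.joint
  fun_prop

lemma measurableSet_covers {α : Type*} [MeasurableSpace α] {f g : α → Grain d}
    (hf : Measurable f) (hg : Measurable g) : MeasurableSet {a | (f a).Covers (g a)} :=
  measurableSet_le (by fun_prop) (by fun_prop)

lemma meetTime_eq_iInf_denseSeq (u v : Grain d) :
    u.meetTime v = ⨅ n, u.joint v (denseSeq (EuclideanSpace ℝ (Fin d)) n) :=
  by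
  rw [Grain.meetTime, ← (denseRange_denseSeq _).ciInf' (u.continuous_joint v), iInf_range']

@[fun_prop] lemma _root_.Measurable.meetTime {α : Type*} [MeasurableSpace α] {f g : α → Grain d}
    (hf : Measurable f) (hg : Measurable g) : Measurable fun a => (f a).meetTime (g a) := by
  simp_rw [meetTime_eq_iInf_denseSeq]
  exact Measurable.iInf fun n => by fun_prop

end Grain

/-! ### Configurations as kernels and measurable counts. -/

/-- The counting measure on the grains of a configuration. -/
def Config.toMeasure (ψ : Config d) : Measure (Grain d) :=
  Measure.sum fun u : ψ.carrier => Measure.dirac (u : Grain d)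

lemma Config.lintegral_toMeasure (ψ : Config d) {f : Grain d → ℝ≥0∞} (hf : Measurable f) :
    ∫⁻ u, f u ∂ψ.toMeasure = ∑' u : ψ.carrier, f u := by
  rw [Config.toMeasure, lintegral_sum_measure]
  simp_rw [lintegral_dirac' _ hf]

lemma Config.toMeasure_apply (ψ : Config d) {C : Set (Grain d)} (hC : MeasurableSet C) :
    ψ.toMeasure C = ((ψ.carrier ∩ C).encard : ℕ∞) := by
  rw [← lintegral_indicator_one hC, ψ.lintegral_toMeasure (measurable_one.indicator hC),
    ← ENNReal.tsum_set_one, tsum_subtype ψ.carrier (C.indicator 1),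
    tsum_subtype (ψ.carrier ∩ C) (fun _ => (1 : ℝ≥0∞)), Set.indicator_indicator]
  rfl

lemma Config.measurable_toMeasure : Measurable (Config.toMeasure (d := d)) := by
  refine Measure.measurable_of_measurable_coe _ fun C hC => ?_
  simp_rw [Config.toMeasure_apply _ hC]
  intro B hB
  have h2 : MeasurableSet[MeasurableSpace.comap
      (fun ψ : Config d => (ψ.carrier ∩ C).encard) ⊤]
      ((fun ψ : Config d => (((ψ.carrier ∩ C).encard : ℕ∞) : ℝ≥0∞)) ⁻¹' B) :=
    ⟨(fun n : ℕ∞ => (n : ℝ≥0∞)) ⁻¹' B, trivial, rfl⟩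
  exact le_iSup₂_of_le (f := fun (C : Set (Grain d)) (_ : MeasurableSet C) =>
      MeasurableSpace.comap (fun ψ : Config d => (ψ.carrier ∩ C).encard) ⊤) C hC le_rfl _ h2

/-- The kernel sending a configuration to its counting measure. -/
def grainKernel (d : ℕ) : ProbabilityTheory.Kernel (Config d) (Grain d) :=
  ⟨Config.toMeasure, Config.measurable_toMeasure⟩

/-- The grains whose position has norm in `[n, n + 1)`. -/
def shell (d n : ℕ) : Set (Grain d) := {u | ⌊‖u.pos‖₊⌋₊ = n}

lemma measurableSet_shell (n : ℕ) : MeasurableSet (shell d n) :=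
  measurableSet_eq_fun (Nat.measurable_floor.comp (by fun_prop)) measurable_const

lemma Config.toMeasure_shell_lt_top (ψ : Config d) (n : ℕ) : ψ.toMeasure (shell d n) < ∞ := by
  rw [ψ.toMeasure_apply (measurableSet_shell n)]
  have h : (ψ.carrier ∩ shell d n).Finite := by
    refine (ψ.locallyFinite (closedBall 0 (n + 1)) isBounded_closedBall).subset ?_
    rintro u ⟨hu, hn⟩
    refine ⟨hu, ?_⟩
    have hn : ⌊‖u.pos‖₊⌋₊ = n := hn
    rw [mem_closedBall_zero_iff]
    have := (Nat.lt_floor_add_one ‖u.pos‖₊).le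
    rw [hn] at this
    exact_mod_cast this
  rw [← h.cast_ncard_eq]
  exact ENNReal.natCast_lt_top _

/-- The total masses may be unbounded, so the kernel is cut into pieces according to their integer
parts. -/
lemma isSFiniteKernel_of_forall_lt_top {α β : Type*} [MeasurableSpace α] [MeasurableSpace β]
    (κ : ProbabilityTheory.Kernel α β) (h : ∀ a, κ a univ < ∞) :
    ProbabilityTheory.IsSFiniteKernel κ := by
  classical
  set N : α → ℕ := fun a => ⌊(κ a univ).toNNReal⌋₊
  have hN : Measurable N :=
    Nat.measurable_floor.comp (κ.measurable_coe MeasurableSet.univ).ennreal_toNNReal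
  have hs : ∀ n, MeasurableSet (N ⁻¹' {n}) := fun n => hN (measurableSet_singleton n)
  have hsum : κ = ProbabilityTheory.Kernel.sum fun n =>
      ProbabilityTheory.Kernel.piecewise (hs n) κ 0 := by
    ext a C hC
    rw [ProbabilityTheory.Kernel.sum_apply' _ _ hC, tsum_eq_single (N a)]
    · rw [ProbabilityTheory.Kernel.piecewise_apply, if_pos (by rfl)]
    · intro n hn
      rw [ProbabilityTheory.Kernel.piecewise_apply, if_neg (show a ∉ N ⁻¹' {n} from fun h => hn (Eq.symm h))]
      rfl
  rw [hsum]
  have : ∀ n, ProbabilityTheory.IsFiniteKernel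
      (ProbabilityTheory.Kernel.piecewise (hs n) κ 0) := by
    refine fun n => ⟨⟨n + 1, by simp, fun a => ?_⟩⟩
    rw [ProbabilityTheory.Kernel.piecewise_apply]
    split_ifs with ha
    · have ha : N a = n := ha
      rw [← ENNReal.coe_toNNReal (h a).ne]
      have := (Nat.lt_floor_add_one (κ a univ).toNNReal).le
      change _ ≤ ((N a : ℝ≥0) + 1) at this
      rw [ha] at this
      exact_mod_cast this
    · simp
  infer_instance

instance : ProbabilityTheory.IsSFiniteKernel (grainKernel d) := by
  have hsum : grainKernel d = ProbabilityTheory.Kernel.sum fun n =>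
      (grainKernel d).restrict (measurableSet_shell n) := by
    ext ψ C hC
    rw [ProbabilityTheory.Kernel.sum_apply' _ _ hC]
    simp_rw [ProbabilityTheory.Kernel.restrict_apply, Measure.restrict_apply hC]
    rw [← measure_iUnion]
    · congr 1
      rw [← inter_iUnion, eq_comm, inter_eq_left]
      exact fun u _ => mem_iUnion.2 ⟨_, rfl⟩
    · intro m n hmn
      refine Set.disjoint_left.2 fun u hm hn => hmn (Eq.trans (Eq.symm hm.2) hn.2)
    · exact fun n => hC.inter (measurableSet_shell n)
  rw [hsum]
  have : ∀ n, ProbabilityTheory.IsSFiniteKernel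
      ((grainKernel d).restrict (measurableSet_shell n)) := fun n => by
    refine isSFiniteKernel_of_forall_lt_top _ fun ψ => ?_
    rw [ProbabilityTheory.Kernel.restrict_apply, Measure.restrict_apply_univ]
    exact ψ.toMeasure_shell_lt_top n
  infer_instance

/-- A sum over a configuration is an integral against the s-finite kernel `grainKernel`. -/
lemma measurable_tsum_carrier {α : Type*} [MeasurableSpace α] {ψ : α → Config d}
    (hψ : Measurable ψ) {f : α → Grain d → ℝ≥0∞} (hf : Measurable (Function.uncurry f)) :
    Measurable fun a => ∑' u : (ψ a).carrier, f a u := by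
  have h1 : Measurable fun p : Config d × α => ∫⁻ u, f p.2 u ∂(grainKernel d) p.1 := by
    have := Measurable.lintegral_kernel_prod_right
      (κ := (grainKernel d).comap (Prod.fst : Config d × α → Config d) measurable_fst)
      (f := fun p u => f p.2 u) (hf.comp (by fun_prop : Measurable
        fun q : (Config d × α) × Grain d => (q.1.2, q.2)))
    exact this
  have h2 := h1.comp (hψ.prodMk measurable_id)
  convert h2 using 2 with a
  exact ((ψ a).lintegral_toMeasure (hf.comp measurable_prodMk_left)).symm

lemma measurableSet_exists_mem_carrier {α : Type*} [MeasurableSpace α] {ψ : α → Config d}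
    (hψ : Measurable ψ) {S : Set (α × Grain d)} (hS : MeasurableSet S) :
    MeasurableSet {a | ∃ u ∈ (ψ a).carrier, (a, u) ∈ S} := by
  have h := measurable_tsum_carrier hψ (f := fun a u => S.indicator 1 (a, u))
    (measurable_one.indicator hS)
  convert (h (measurableSet_singleton 0)).compl using 1
  ext a
  simp [ENNReal.tsum_eq_zero, mem_preimage]

lemma encard_eq_tsum_cons (A : Set (Grain d)) (k : ℕ) (S : Set (Fin (k + 1) → Grain d)) :
    (({u : Fin (k + 1) → Grain d | (∀ i, u i ∈ A) ∧ u ∈ S}.encard : ℕ∞) : ℝ≥0∞) =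
      ∑' v : A, (({w : Fin k → Grain d |
        (∀ i, w i ∈ A) ∧ (Fin.cons (v : Grain d) w : Fin (k + 1) → Grain d) ∈ S}.encard : ℕ∞) :
          ℝ≥0∞) := by
  rw [← ENNReal.tsum_set_one, tsum_subtype _ (fun _ => (1 : ℝ≥0∞)),
    ← (Fin.consEquiv (fun _ : Fin (k + 1) => Grain d)).tsum_eq, ENNReal.tsum_prod',
    tsum_subtype A (fun v => (({w : Fin k → Grain d |
        (∀ i, w i ∈ A) ∧ (Fin.cons v w : Fin (k + 1) → Grain d) ∈ S}.encard : ℕ∞) : ℝ≥0∞))]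
  congr 1
  ext v
  by_cases hv : v ∈ A
  · rw [indicator_of_mem hv, ← ENNReal.tsum_set_one, tsum_subtype _ (fun _ => (1 : ℝ≥0∞))]
    congr 1
    ext w
    have hiff : (∀ i, (Fin.cons v w : Fin (k + 1) → Grain d) i ∈ A) ↔ ∀ i, w i ∈ A :=
      ⟨fun h i => h i.succ, fun h => Fin.cases hv h⟩
    by_cases hw : w ∈ {w : Fin k → Grain d |
        (∀ i, w i ∈ A) ∧ (Fin.cons v w : Fin (k + 1) → Grain d) ∈ S}
    · rw [indicator_of_mem hw]
      exact indicator_of_mem (show Fin.cons v w ∈ {u : Fin (k + 1) → Grain d |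
        (∀ i, u i ∈ A) ∧ u ∈ S} from ⟨hiff.2 hw.1, hw.2⟩) _
    · rw [indicator_of_notMem hw]
      exact indicator_of_notMem (show Fin.cons v w ∉ {u : Fin (k + 1) → Grain d |
        (∀ i, u i ∈ A) ∧ u ∈ S} from fun h => hw ⟨hiff.1 h.1, h.2⟩) _
  · rw [indicator_of_notMem hv, ENNReal.tsum_eq_zero]
    intro w
    refine indicator_of_notMem (fun h => hv ?_) _
    exact h.1 0

/-- Generality in the parameter space drives the induction: the first coordinate becomes a parameter
and is then summed out. -/
lemma measurable_encard_tuples_aux (k : ℕ) {β : Type} [MeasurableSpace β] {φ : β → Config d}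
    (hφ : Measurable φ) {S : Set (β × (Fin k → Grain d))} (hS : MeasurableSet S) :
    Measurable fun b => (({u : Fin k → Grain d |
      (∀ i, u i ∈ (φ b).carrier) ∧ (b, u) ∈ S}.encard : ℕ∞) : ℝ≥0∞) := by
  induction k generalizing β with
  | zero =>
    have h : MeasurableSet {b : β | (b, (default : Fin 0 → Grain d)) ∈ S} :=
      hS.preimage measurable_prodMk_right
    convert (measurable_one (α := ℝ≥0∞)).indicator h with b
    by_cases hb : (b, (default : Fin 0 → Grain d)) ∈ S
    · rw [indicator_of_mem (show b ∈ {b : β | (b, (default : Fin 0 → Grain d)) ∈ S} from hb)]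
      have : {u : Fin 0 → Grain d | (∀ i, u i ∈ (φ b).carrier) ∧ (b, u) ∈ S} = {default} := by
        ext u
        simp [Subsingleton.elim u default, hb]
      rw [this]
      simp
    · rw [indicator_of_notMem (show b ∉ {b : β | (b, (default : Fin 0 → Grain d)) ∈ S} from hb)]
      have : {u : Fin 0 → Grain d | (∀ i, u i ∈ (φ b).carrier) ∧ (b, u) ∈ S} = ∅ := by
        ext u
        simp [Subsingleton.elim u default, hb]
      rw [this]
      simp
  | succ k ih =>
    have hm : Measurable fun q : (β × Grain d) × (Fin k → Grain d) =>
        (q.1.1, (Fin.cons q.1.2 q.2 : Fin (k + 1) → Grain d)) := by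
      refine (measurable_fst.comp measurable_fst).prodMk (measurable_pi_iff.2 fun i => ?_)
      refine Fin.cases ?_ (fun i => ?_) i
      · exact measurable_snd.comp measurable_fst
      · exact (measurable_pi_apply i).comp measurable_snd
    have h := ih (β := β × Grain d) (φ := fun q => φ q.1) (hφ.comp measurable_fst) (hS.preimage hm)
    convert measurable_tsum_carrier hφ (f := fun b v => (({w : Fin k → Grain d |
        (∀ i, w i ∈ (φ b).carrier) ∧
          (b, (Fin.cons v w : Fin (k + 1) → Grain d)) ∈ S}.encard : ℕ∞) : ℝ≥0∞)) h using 2 with b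
    exact encard_eq_tsum_cons (φ b).carrier k {u | (b, u) ∈ S}

lemma measurableSet_injective (k : ℕ) :
    MeasurableSet {u : Fin k → Grain d | Function.Injective u} := by
  have : {u : Fin k → Grain d | Function.Injective u} =
      ⋂ (i) (j) (_ : i ≠ j), {u | u i = u j}ᶜ := by
    ext u
    simp only [mem_ofPred_eq, mem_iInter, mem_compl_iff, Function.Injective]
    exact forall₂_congr fun i j => not_imp_not.symm
  rw [this]
  refine .iInter fun i => .iInter fun j => .iInter fun _ => (MeasurableSet.compl ?_)
  exact (isClosed_eq (continuous_apply i) (continuous_apply j)).measurableSet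

/-- The number of `k`-tuples of different grains of a configuration in a measurable set is
measurable. -/
lemma measurable_encard_tuples (k : ℕ) {C : Set (Fin k → Grain d)} (hC : MeasurableSet C) :
    Measurable fun ψ : Config d => (({u : Fin k → Grain d |
      Function.Injective u ∧ (∀ i, u i ∈ ψ.carrier) ∧ u ∈ C}.encard : ℕ∞) : ℝ≥0∞) := by
  convert measurable_encard_tuples_aux k (φ := fun ψ : Config d => ψ) measurable_id
    (S := Prod.snd ⁻¹' ({u | Function.Injective u} ∩ C))
    (((measurableSet_injective k).inter hC).preimage measurable_snd) using 5 with ψ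
  ext u
  constructor
  · exact fun h => ⟨h.2.1, h.1, h.2.2⟩
  · exact fun h => ⟨h.2.1, h.1, h.2.2⟩

/-- Both conditions on `y` are strict and therefore open, so `y` may be restricted to a dense
sequence. -/
lemma measurable_nextEnd {s : Config d × Grain d → ℝ≥0∞} (hs : Measurable s) :
    Measurable fun p : Config d × Grain d =>
      nextEnd p.1.carrier (fun v => s (p.1, v)) p.2 := by
  refine measurable_of_Iio fun c => ?_
  set D := denseSeq (EuclideanSpace ℝ (Fin d))
  have h : (fun p : Config d × Grain d =>
      nextEnd p.1.carrier (fun v => s (p.1, v)) p.2) ⁻¹' Iio c =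
      {p | ∃ v ∈ p.1.carrier, (p, v) ∈ {q : (Config d × Grain d) × Grain d |
        q.2 ≠ q.1.2 ∧ ¬ q.1.2.Covers q.2 ∧ ∃ n, (q.2.arrival (D n) : ℝ≥0∞) < s (q.1.1, q.2) ∧
          (q.1.2.joint q.2 (D n) : ℝ≥0∞) < c}} := by
    ext p
    rw [mem_preimage, mem_Iio, nextEnd_lt_iff]
    refine exists_congr fun v => and_congr_right fun _ => and_congr_right fun _ =>
      and_congr_right fun _ => ?_
    constructor
    · intro ⟨y, hy⟩
      have hopen : IsOpen {y | (v.arrival y : ℝ≥0∞) < s (p.1, v) ∧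
          (p.2.joint v y : ℝ≥0∞) < c} :=
        (isOpen_lt (ENNReal.continuous_coe.comp v.continuous_arrival) continuous_const).inter
          (isOpen_lt (ENNReal.continuous_coe.comp (p.2.continuous_joint v)) continuous_const)
      obtain ⟨_, hz, n, rfl⟩ := (denseRange_denseSeq _).inter_open_nonempty _ hopen ⟨y, hy⟩
      exact ⟨n, hz⟩
    · exact fun ⟨n, hn⟩ => ⟨_, hn⟩
  rw [h]
  refine measurableSet_exists_mem_carrier measurable_fst (.inter ?_ (.inter ?_ ?_))
  · exact (isOpen_ne_fun continuous_snd continuous_fst).measurableSet.preimage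
      (by fun_prop : Measurable fun q : (Config d × Grain d) × Grain d => (q.1.2, q.2))
  · exact (Grain.measurableSet_covers (measurable_snd.comp measurable_fst) measurable_snd).compl
  · have : {q : (Config d × Grain d) × Grain d | ∃ n,
        (q.2.arrival (D n) : ℝ≥0∞) < s (q.1.1, q.2) ∧ (q.1.2.joint q.2 (D n) : ℝ≥0∞) < c} =
      ⋃ n, {q | (q.2.arrival (D n) : ℝ≥0∞) < s (q.1.1, q.2) ∧
        (q.1.2.joint q.2 (D n) : ℝ≥0∞) < c} := by
      ext; simp
    change MeasurableSet {q : (Config d × Grain d) × Grain d | ∃ n,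
        (q.2.arrival (D n) : ℝ≥0∞) < s (q.1.1, q.2) ∧ (q.1.2.joint q.2 (D n) : ℝ≥0∞) < c}
    rw [this]
    refine .iUnion fun n => ?_
    have h1 : MeasurableSet {q : (Config d × Grain d) × Grain d |
        (q.2.arrival (D n) : ℝ≥0∞) < s (q.1.1, q.2)} :=
      measurableSet_lt (by fun_prop) (by fun_prop)
    have h2 : MeasurableSet {q : (Config d × Grain d) × Grain d |
        (q.1.2.joint q.2 (D n) : ℝ≥0∞) < c} :=
      measurableSet_lt (by fun_prop) (by fun_prop)
    exact h1.inter h2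

lemma measurable_endTime :
    Measurable fun p : Config d × Grain d => endTime p.1.carrier p.2 := by
  have h : ∀ n, Measurable fun p : Config d × Grain d => endLower p.1.carrier n p.2 := by
    intro n
    induction n with
    | zero => exact measurable_const
    | succ n ih =>
      have h1 := measurable_nextEnd ih
      have h2 := measurable_nextEnd h1
      exact h2
  exact Measurable.iSup h

/-! ### Radii and volumes of boundary layers. -/

/-- The largest norm of a point of the shape. -/
def Shape.rad (K : Shape d) : ℝ≥0 := nndist K.1 0

@[fun_prop] lemma Shape.measurable_rad : Measurable (Shape.rad (d := d)) := by
  have h : Continuous (Shape.rad (d := d)) :=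
    Continuous.nndist (continuous_subtype_val (p := fun K : ConvexBody (EuclideanSpace ℝ (Fin d)) =>
      (0 : EuclideanSpace ℝ (Fin d)) ∈ interior (K : Set (EuclideanSpace ℝ (Fin d)))))
      continuous_const
  exact h.measurable

lemma Shape.coe_rad (K : Shape d) : (K.rad : ℝ) = hausdorffDist K.toSet {0} := rfl

lemma Shape.norm_le_rad (K : Shape d) {z : EuclideanSpace ℝ (Fin d)} (hz : z ∈ K.toSet) :
    ‖z‖ ≤ K.rad := by
  have h := infDist_le_hausdorffDist_of_mem (t := {(0 : EuclideanSpace ℝ (Fin d))}) hz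
    (hausdorffEDist_ne_top_of_nonempty_of_bounded ⟨0, K.zero_mem⟩ (singleton_nonempty 0)
      K.isCompact.isBounded Bornology.isBounded_singleton)
  rwa [infDist_singleton, dist_zero_right] at h

lemma Shape.circumradius_nonneg (K : Shape d) : 0 ≤ K.circumradius :=
  Real.sInf_nonneg fun _ h => h.1

lemma Shape.rad_le (K : Shape d) : (K.rad : ℝ) ≤ 2 * K.circumradius := by
  have h : (K.rad : ℝ) / 2 ≤ K.circumradius := by
    obtain ⟨r, hr⟩ := K.isCompact.isBounded.subset_closedBall 0
    refine le_csInf ⟨max r 0, le_max_right _ _, 0, hr.trans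
      (closedBall_subset_closedBall (le_max_left _ _))⟩ ?_
    rintro s ⟨hs, c, hc⟩
    have h2 : (K.rad : ℝ) ≤ 2 * s := by
      rw [Shape.coe_rad]
      have h0 := hc K.zero_mem
      have hz : ∀ z ∈ K.toSet, dist z 0 ≤ 2 * s := fun z hz => by
        linarith [dist_triangle_right z 0 c, mem_closedBall.1 (hc hz), mem_closedBall.1 h0]
      refine hausdorffDist_le_of_mem_dist (by linarith) (fun z hz' => ⟨0, rfl, hz z hz'⟩) ?_
      rintro z rfl
      exact ⟨0, K.zero_mem, by simpa using hs⟩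
    linarith
  linarith

lemma Grain.dist_pos_le (u : Grain d) {y : EuclideanSpace ℝ (Fin d)} {r : ℝ≥0}
    (h : u.reachTime y ≤ r) : dist y u.pos ≤ r * u.shape.rad := by
  obtain ⟨z, hz, rfl⟩ := (u.mem_grown_iff r y).2 h
  rw [dist_eq_norm, add_sub_cancel_left, norm_smul, Real.norm_of_nonneg r.coe_nonneg]
  exact mul_le_mul_of_nonneg_left (u.shape.norm_le_rad hz) r.coe_nonneg

/-- If `m` translates of `D` are disjoint and contained in `W`, then `D` has at most the `m`-th part
of the volume of `W`. -/
lemma natCast_mul_volume_le {D W : Set (EuclideanSpace ℝ (Fin d))} (hD : MeasurableSet D) (m : ℕ)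
    (w : EuclideanSpace ℝ (Fin d)) (hW : ∀ y ∈ D, ∀ k : ℕ, k < m → y + (k : ℝ) • w ∈ W)
    (hdisj : ∀ y ∈ D, ∀ k : ℕ, 1 ≤ k → k ≤ m → y + (k : ℝ) • w ∉ D) :
    m * volume D ≤ volume W := by
  set T : ℕ → Set (EuclideanSpace ℝ (Fin d)) := fun k => (fun z => z + -((k : ℝ) • w)) ⁻¹' D
  have hT : ∀ k, MeasurableSet (T k) := fun k => hD.preimage (by fun_prop)
  have hvol : ∀ k, volume (T k) = volume D := fun k => measure_preimage_add_right _ _ _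
  have hne : ∀ k l, k < l → l < m → Disjoint (T k) (T l) := by
    intro k l hkl hlm
    refine Set.disjoint_left.2 fun z hz hz' => ?_
    refine hdisj _ hz' (l - k) (by omega) (by omega) ?_
    convert (show z + -((k : ℝ) • w) ∈ D from hz) using 1
    rw [Nat.cast_sub hkl.le]
    module
  calc (m : ℝ≥0∞) * volume D = ∑ k ∈ Finset.range m, volume (T k) := by simp [hvol]
    _ = volume (⋃ k ∈ Finset.range m, T k) := by
      refine (measure_biUnion_finset (fun k hk l hl hkl => ?_) fun k _ => hT k).symm
      rw [Finset.coe_range, mem_Iio] at hk hl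
      rcases lt_or_gt_of_ne hkl with h | h
      · exact hne k l h hl
      · exact (hne l k h hk).symm
    _ ≤ volume W := by
      refine measure_mono fun z hz => ?_
      simp only [mem_iUnion, Finset.mem_range, exists_prop] at hz
      obtain ⟨k, hk, hz⟩ := hz
      simpa using hW _ hz k hk

/-- The boundary layer of a convex set of outer thickness `h` has small volume. -/
lemma volume_cthickening_diff_le {A : Set (EuclideanSpace ℝ (Fin d))} (hconv : Convex ℝ A)
    (hcomp : IsCompact A) {x : EuclideanSpace ℝ (Fin d)} {h : ℝ} (hh : 0 ≤ h) {m : ℕ}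
    (hm : 1 ≤ m) (hA : A ⊆ closedBall x (m * h)) (hd : 0 < d) :
    m * volume (cthickening h A \ A) ≤ 2 * d * volume (closedBall x ((d + 2) * (m * h))) := by
  set A' := cthickening h A
  set W := closedBall x ((d + 2) * (m * h))
  have hm' : (1 : ℝ) ≤ m := by exact_mod_cast hm
  have hd' : (0 : ℝ) < d := by exact_mod_cast hd
  have hnear : ∀ y ∈ A', ∃ a ∈ A, dist y a ≤ h := by
    intro y hy
    change y ∈ cthickening h A at hy
    rw [hcomp.cthickening_eq_biUnion_closedBall hh] at hy
    simpa using hy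
  -- Layer points that the shifts by multiples of `d * h` along `e` move out of the thickened set;
  -- such shifts of `D e` are disjoint.
  set D : EuclideanSpace ℝ (Fin d) → Set (EuclideanSpace ℝ (Fin d)) := fun e =>
    (A' \ A) ∩ ⋂ k ∈ Finset.Icc 1 m, (fun y => y + (k : ℝ) • ((d * h) • e)) ⁻¹' A'ᶜ
  have hDm : ∀ e, MeasurableSet (D e) := by
    intro e
    refine (isClosed_cthickening.measurableSet.diff hcomp.isClosed.measurableSet).inter ?_
    refine Finset.measurableSet_biInter _ fun k _ => ?_
    exact isClosed_cthickening.measurableSet.compl.preimage (by fun_prop)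
  have hDvol : ∀ e : EuclideanSpace ℝ (Fin d), ‖e‖ = 1 → m * volume (D e) ≤ volume W := by
    intro e he
    refine natCast_mul_volume_le (hDm e) m ((d * h) • e) (fun y hy k hk => ?_)
      (fun y hy k hk hkm hy' => ?_)
    · obtain ⟨a, ha, hya⟩ := hnear y hy.1.1
      rw [mem_closedBall]
      have h1 := mem_closedBall.1 (hA ha)
      have h2 : dist (y + (k : ℝ) • ((d * h) • e)) y ≤ m * (d * h) := by
        rw [dist_eq_norm, add_sub_cancel_left, norm_smul, norm_smul, he, mul_one,
          Real.norm_of_nonneg (by positivity), Real.norm_of_nonneg (by positivity)]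
        have : (k : ℝ) ≤ m := by exact_mod_cast hk.le
        gcongr
      have h3 := dist_triangle4 (y + (k : ℝ) • ((d * h) • e)) y a x
      nlinarith
    · have := mem_iInter₂.1 hy.2 k (Finset.mem_Icc.2 ⟨hk, hkm⟩)
      exact this hy'.1.1
  have hcover : A' \ A ⊆ ⋃ i : Fin d, (D (EuclideanSpace.single i 1) ∪
      D (-EuclideanSpace.single i 1)) := by
    intro y hy
    -- A functional separates `y` from `A`. A step `d * h` in a direction with `‖f‖ ≤ d * f e`
    -- raises `f` by at least `‖f‖ * h`, hence leaves the thickening; some signed basis vector is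
    -- such a direction.
    obtain ⟨f, c, hf, hc⟩ := geometric_hahn_banach_closed_point hconv hcomp.isClosed hy.2
    have key : ∀ e : EuclideanSpace ℝ (Fin d), ‖f‖ ≤ d * f e → y ∈ D e := by
      intro e he
      refine ⟨hy, mem_iInter₂.2 fun k hk hmem => ?_⟩
      obtain ⟨a, ha, hya⟩ := hnear _ hmem
      have h1 : f (y + (k : ℝ) • ((d * h) • e)) - f a ≤ ‖f‖ * h := by
        rw [← map_sub]
        refine (le_abs_self _).trans ((f.le_opNorm _).trans ?_)
        rw [← dist_eq_norm]
        gcongr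
      have h2 : f (y + (k : ℝ) • ((d * h) • e)) = f y + k * (h * (d * f e)) := by
        simp only [map_add, map_smul, smul_eq_mul]
        ring
      have h3 := hf a ha
      have hk1 : (1 : ℝ) ≤ k := by exact_mod_cast (Finset.mem_Icc.1 hk).1
      have h4 : ‖f‖ * h ≤ h * (d * f e) := by nlinarith
      have h5 : h * (d * f e) ≤ k * (h * (d * f e)) :=
        le_mul_of_one_le_left ((by positivity : 0 ≤ ‖f‖ * h).trans h4) hk1
      linarith
    have hex : ∃ i : Fin d, ‖f‖ ≤ d * |f (EuclideanSpace.single i 1)| := by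
      by_contra! hcon
      have hne : Nonempty (Fin d) := ⟨⟨0, hd⟩⟩
      obtain ⟨i, -, hi⟩ := Finset.exists_max_image Finset.univ
        (fun i : Fin d => |f (EuclideanSpace.single i 1)|) Finset.univ_nonempty
      refine absurd (hcon i) (not_lt.2 (f.opNorm_le_bound (by positivity) fun z => ?_))
      have hz : z = ∑ j, z j • EuclideanSpace.single j (1 : ℝ) := by
        conv_lhs => rw [← (EuclideanSpace.basisFun (Fin d) ℝ).sum_repr z]
        simp
      calc ‖f z‖ = ‖∑ j, z j * f (EuclideanSpace.single j (1 : ℝ))‖ := by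
            conv_lhs => rw [hz]
            simp only [map_sum, map_smul, smul_eq_mul]
        _ ≤ ∑ j, ‖z j * f (EuclideanSpace.single j (1 : ℝ))‖ := norm_sum_le _ _
        _ ≤ ∑ _j : Fin d, ‖z‖ * |f (EuclideanSpace.single i 1)| := by
            refine Finset.sum_le_sum fun j _ => ?_
            rw [norm_mul]
            exact mul_le_mul (PiLp.norm_apply_le z j) (hi j (Finset.mem_univ j)) (norm_nonneg _)
              (norm_nonneg _)
        _ = d * |f (EuclideanSpace.single i 1)| * ‖z‖ := by
            simp
            ring
    obtain ⟨i, hi⟩ := hex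
    refine mem_iUnion.2 ⟨i, ?_⟩
    rcases abs_cases (f (EuclideanSpace.single i 1)) with h | h
    · exact Or.inl (key _ (by rwa [h.1] at hi))
    · exact Or.inr (key _ (by rwa [h.1, ← map_neg] at hi))
  calc (m : ℝ≥0∞) * volume (A' \ A)
      ≤ m * ∑ i : Fin d, (volume (D (EuclideanSpace.single i 1)) +
          volume (D (-EuclideanSpace.single i 1))) := by
        gcongr
        refine (measure_mono hcover).trans ((measure_iUnion_fintype_le _ _).trans ?_)
        exact Finset.sum_le_sum fun i _ => measure_union_le _ _
    _ = ∑ i : Fin d, (m * volume (D (EuclideanSpace.single i 1)) +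
          m * volume (D (-EuclideanSpace.single i 1))) := by
        simp only [Finset.mul_sum, mul_add]
    _ ≤ ∑ _i : Fin d, (volume W + volume W) := by
        refine Finset.sum_le_sum fun i _ => add_le_add (hDvol _ ?_) (hDvol _ ?_)
        · simp
        · simp
    _ = 2 * d * volume W := by
        simp
        ring

/-! ### Positions of neighbours in a time window. -/

lemma Grain.dist_pos_pos_le {u v : Grain d} {b : ℝ≥0} (h : u.meetTime v ≤ b) :
    u.birth ≤ b ∧ v.birth ≤ b ∧ dist v.pos u.pos ≤
      (b - u.birth) * u.shape.rad + (b - v.birth) * v.shape.rad := by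
  obtain ⟨y, hy⟩ := u.exists_joint_eq_meetTime v
  have hu : u.arrival y ≤ b := (le_max_left _ _).trans (hy.le.trans h)
  have hv : v.arrival y ≤ b := (le_max_right _ _).trans (hy.le.trans h)
  have hub := (u.birth_le_arrival y).trans hu
  have hvb := (v.birth_le_arrival y).trans hv
  refine ⟨hub, hvb, ?_⟩
  have h1 := u.dist_pos_le (y := y) (r := b - u.birth) (le_tsub_of_add_le_left hu)
  have h2 := v.dist_pos_le (y := y) (r := b - v.birth) (le_tsub_of_add_le_left hv)
  rw [NNReal.coe_sub hub] at h1
  rw [NNReal.coe_sub hvb] at h2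
  linarith [dist_triangle_left v.pos u.pos y]

/-- The positions at which the grain `u` meets a grain with birth time `t` and shape `K` in a time
window of length `ε` lie in a thin boundary layer if `u` is born before the window. -/
lemma windowEdge_subset (u : Grain d) (t : ℝ≥0) (K : Shape d) {a ε : ℝ≥0} {m : ℕ}
    (hb : a + ε ≤ m * ε) (hu : u.birth ≤ a) (ht : t ≤ a + ε) :
    ∃ A : Set (EuclideanSpace ℝ (Fin d)), Convex ℝ A ∧ IsCompact A ∧
      A ⊆ closedBall u.pos (m * (ε * (u.shape.rad + K.rad) : ℝ)) ∧
      {x | WindowEdge a (a + ε) u (x, t, K)} ⊆ cthickening (ε * (u.shape.rad + K.rad)) A \ A := by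
  set s := max a t
  have hus : u.birth ≤ s := hu.trans (le_max_left _ _)
  have hts : t ≤ s := le_max_right _ _
  have hsb : s ≤ a + ε := max_le le_self_add ht
  have hus' : (u.birth : ℝ) ≤ s := by exact_mod_cast hus
  have hts' : (t : ℝ) ≤ s := by exact_mod_cast hts
  have hsb' : (s : ℝ) ≤ a + ε := by exact_mod_cast hsb
  have has' : (a : ℝ) ≤ s := by exact_mod_cast le_max_left a t
  have hb' : (a : ℝ) + ε ≤ m * ε := by exact_mod_cast hb
  have hrK : (0 : ℝ) ≤ K.rad := K.rad.coe_nonneg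
  have hru : (0 : ℝ) ≤ u.shape.rad := u.shape.rad.coe_nonneg
  let F : EuclideanSpace ℝ (Fin d) × EuclideanSpace ℝ (Fin d) →ₗ[ℝ] EuclideanSpace ℝ (Fin d) :=
    ((s - u.birth : ℝ)) • LinearMap.fst ℝ _ _ - ((s - t : ℝ)) • LinearMap.snd ℝ _ _
  have hF : ∀ p, F p = (s - u.birth : ℝ) • p.1 - (s - t : ℝ) • p.2 := fun p => rfl
  -- The convex set consists of the positions `x` at which the grain with mark `(t, K)` has met `u`
  -- by the time `s`; growth during the rest of the window thickens it.
  refine ⟨(fun z => u.pos + z) '' (F '' (u.shape.toSet ×ˢ K.toSet)), ?_, ?_, ?_, ?_⟩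
  · exact ((u.shape.convex.prod K.convex).linear_image F).translate u.pos
  · exact ((u.shape.isCompact.prod K.isCompact).image F.continuous_of_finiteDimensional).image
      (by fun_prop)
  · rintro _ ⟨_, ⟨⟨k, k'⟩, ⟨hk, hk'⟩, rfl⟩, rfl⟩
    rw [mem_closedBall, dist_eq_norm, add_sub_cancel_left, hF]
    refine (norm_sub_le _ _).trans ?_
    rw [norm_smul, norm_smul, Real.norm_of_nonneg (sub_nonneg.2 hus'),
      Real.norm_of_nonneg (sub_nonneg.2 hts')]
    have h1 := u.shape.norm_le_rad hk
    have h2 := K.norm_le_rad hk'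
    have h3 : (s - u.birth : ℝ) ≤ m * ε := by linarith [u.birth.coe_nonneg]
    have h4 : (s - t : ℝ) ≤ m * ε := by linarith [t.coe_nonneg]
    calc (s - u.birth : ℝ) * ‖k‖ + (s - t) * ‖k'‖ ≤
        (m * ε) * u.shape.rad + (m * ε) * K.rad := by gcongr
      _ = _ := by ring
  · intro x hx
    have hx : WindowEdge a (a + ε) u (x, t, K) := hx
    obtain ⟨ha, hle, hc⟩ := hx
    set v : Grain d := (x, t, K)
    constructor
    · obtain ⟨y, hy⟩ := u.exists_joint_eq_meetTime v
      have hu' : u.arrival y ≤ a + ε := (le_max_left _ _).trans (hy.le.trans hle)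
      have hv' : v.arrival y ≤ a + ε := (le_max_right _ _).trans (hy.le.trans hle)
      obtain ⟨k, hk, hky⟩ := (u.mem_grown_iff (a + ε - u.birth) y).2 (le_tsub_of_add_le_left hu')
      obtain ⟨k', hk', hky'⟩ := (v.mem_grown_iff (a + ε - t) y).2 (le_tsub_of_add_le_left hv')
      rw [NNReal.coe_sub (hus.trans hsb)] at hky
      rw [NNReal.coe_sub ht] at hky'
      refine mem_cthickening_of_dist_le x _ _ _ ⟨F (k, k'), ⟨(k, k'), ⟨hk, hk'⟩, rfl⟩, rfl⟩ ?_
      have hxv : v.pos = x := rfl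
      have hx : x - (u.pos + F (k, k')) = (a + ε - s : ℝ) • k - (a + ε - s : ℝ) • k' := by
        have h1 : x = u.pos + ((a + ε - u.birth : ℝ)) • k - ((a + ε - t : ℝ)) • k' := by
          rw [← hxv, eq_sub_iff_add_eq]
          simp only [NNReal.coe_add] at hky hky'
          rw [hky, hky']
        rw [hF, h1]
        module
      rw [dist_eq_norm, hx]
      refine (norm_sub_le _ _).trans ?_
      have h0 : (0 : ℝ) ≤ a + ε - s := sub_nonneg.2 hsb'
      rw [norm_smul, norm_smul, Real.norm_of_nonneg h0, mul_add]
      have h1 := u.shape.norm_le_rad hk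
      have h2 := K.norm_le_rad hk'
      have h3 : (a + ε - s : ℝ) ≤ ε := by linarith
      gcongr
    · rintro ⟨_, ⟨⟨k, k'⟩, ⟨hk, hk'⟩, rfl⟩, hxe⟩
      simp only [hF] at hxe
      set y := u.pos + (s - u.birth : ℝ) • k with hy
      have hyv : v.pos + (s - t : ℝ) • k' = y := by
        change x + _ = _
        rw [hy, ← hxe]
        abel
      have hyu : u.arrival y ≤ s := by
        have : y ∈ u.grown (s - u.birth) := ⟨k, hk, by rw [NNReal.coe_sub hus]⟩
        rw [Grain.mem_grown_iff, Grain.reachTime_le_iff, add_tsub_cancel_of_le hus] at this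
        exact this
      have hyv' : v.arrival y ≤ s := by
        have : y ∈ v.grown (s - t) := ⟨k', hk', by rw [NNReal.coe_sub hts]; exact hyv⟩
        rw [Grain.mem_grown_iff, Grain.reachTime_le_iff] at this
        exact this.trans (add_tsub_cancel_of_le hts).le
      -- A meeting by time `s` either precedes the window or, when `s` is the birth time of `v`,
      -- means that `u` covers `v`; an edge excludes both.
      rcases le_total t a with hta | hat
      · have hs : s = a := max_eq_left hta
        exact absurd ((u.meetTime_le v y).trans (max_le hyu hyv')) (not_le.2 (hs ▸ ha))
      · have hs : s = t := max_eq_right hat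
        have hyp : v.pos = y := by rw [← hyv, hs, sub_self, zero_smul, add_zero]
        apply hc
        change u.arrival v.pos ≤ t
        rw [hyp, ← hs]
        exact hyu

/-- The weight of a grain in the estimate of the number of paths. -/
def windowWeight (a : ℝ≥0) (n : ℕ) (t : ℝ≥0) : ℝ≥0∞ := if a < t then n else 1

lemma natCast_mul_volume_windowEdge_le (hd : 0 < d) (u : Grain d) (t : ℝ≥0) (K : Shape d)
    {a ε : ℝ≥0} {n : ℕ} (hn : 1 ≤ n) (hb : a + ε ≤ (n ^ 2 : ℕ) * ε) :
    n * windowWeight a n t * volume {x | WindowEdge a (a + ε) u (x, t, K)} ≤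
      windowWeight a n u.birth * (2 * d * volume (closedBall u.pos
        ((d + 2) * ((n ^ 2 : ℕ) * (ε * (u.shape.rad + K.rad)) : ℝ)))) := by
  set S := {x | WindowEdge a (a + ε) u (x, t, K)}
  set m := n ^ 2 with hmdef
  set h : ℝ := ε * (u.shape.rad + K.rad) with hh
  set X := 2 * d * volume (closedBall u.pos ((d + 2) * (m * h)))
  have hm : 1 ≤ m := Nat.one_le_pow _ _ hn
  have hn' : (1 : ℝ≥0∞) ≤ n := by exact_mod_cast hn
  have hh0 : 0 ≤ h := by positivity
  have hb' : (a : ℝ) + ε ≤ m * ε := by exact_mod_cast hb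
  have hru : (0 : ℝ) ≤ u.shape.rad := u.shape.rad.coe_nonneg
  have hrK : (0 : ℝ) ≤ K.rad := K.rad.coe_nonneg
  have hmn : (m : ℝ≥0∞) = n * n := by rw [hmdef]; push_cast; ring
  by_cases ht : t ≤ a + ε
  swap
  · have : S = ∅ := eq_empty_of_forall_notMem fun x hx =>
      ht (Grain.dist_pos_pos_le (show WindowEdge a (a + ε) u (x, t, K) from hx).2.1).2.1
    rw [this]
    simp
  have hd2 : (1 : ℝ≥0∞) ≤ 2 * d := by
    have : 1 ≤ 2 * d := by omega
    exact_mod_cast this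
  have hbig : volume S ≤ X := by
    refine le_trans (measure_mono fun x hx => ?_) (le_mul_of_one_le_left zero_le hd2)
    obtain ⟨h1, h2, h3⟩ :=
      Grain.dist_pos_pos_le (show WindowEdge a (a + ε) u (x, t, K) from hx).2.1
    change dist x u.pos ≤ _
    refine le_trans (show dist x u.pos ≤ _ from h3) ?_
    have e1 : ((a + ε : ℝ≥0) : ℝ) - u.birth ≤ m * ε := by
      push_cast; linarith [u.birth.coe_nonneg]
    have e2 : ((a + ε : ℝ≥0) : ℝ) - (t : ℝ) ≤ m * ε := by
      push_cast; linarith [t.coe_nonneg]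
    calc _ ≤ (m * ε) * u.shape.rad + (m * ε) * (K.rad : ℝ) := by
          refine add_le_add (mul_le_mul_of_nonneg_right e1 hru) (mul_le_mul_of_nonneg_right e2 hrK)
      _ = m * h := by rw [hh]; ring
      _ ≤ (d + 2) * (m * h) := le_mul_of_one_le_left (by positivity)
          (by linarith [(Nat.cast_nonneg d : (0 : ℝ) ≤ d)])
  rcases le_or_gt u.birth a with hu | hu
  · obtain ⟨A, hA1, hA2, hA3, hA4⟩ := windowEdge_subset u t K hb hu ht
    have hthin : n * n * volume S ≤ X := by
      rw [← hmn]
      refine le_trans (by gcongr) (volume_cthickening_diff_le hA1 hA2 hh0 hm hA3 hd)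
    have h2 : windowWeight a n t ≤ n := by
      unfold windowWeight
      split_ifs
      exacts [le_rfl, hn']
    -- The layer gains n²; one factor n pays for the weight of the neighbour.
    calc n * windowWeight a n t * volume S ≤ n * n * volume S := by gcongr
      _ ≤ X := hthin
      _ = windowWeight a n u.birth * X := by rw [windowWeight, if_neg (not_lt.2 hu), one_mul]
  · rw [windowWeight, windowWeight, if_pos hu]
    split_ifs with hta
    -- With both births in the window, the grains have had at most time ε to grow.
    · have hthin : n * n * volume S ≤ X := by
        have hsub : S ⊆ closedBall u.pos h := by
          intro x hx
          obtain ⟨h1, h2, h3⟩ :=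
            Grain.dist_pos_pos_le (show WindowEdge a (a + ε) u (x, t, K) from hx).2.1
          change dist x u.pos ≤ _
          refine le_trans (show dist x u.pos ≤ _ from h3) ?_
          have hu' : (a : ℝ) < u.birth := by exact_mod_cast hu
          have hta' : (a : ℝ) < t := by exact_mod_cast hta
          have e1 : ((a + ε : ℝ≥0) : ℝ) - u.birth ≤ ε := by push_cast; linarith
          have e2 : ((a + ε : ℝ≥0) : ℝ) - (t : ℝ) ≤ ε := by push_cast; linarith
          calc _ ≤ ε * (u.shape.rad : ℝ) + ε * (K.rad : ℝ) := by
                refine add_le_add (mul_le_mul_of_nonneg_right e1 hru)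
                  (mul_le_mul_of_nonneg_right e2 hrK)
            _ = h := by rw [hh]; ring
        have hne : Nonempty (Fin d) := ⟨⟨0, hd⟩⟩
        calc n * n * volume S ≤ m * volume (closedBall u.pos h) := by
              rw [hmn]; gcongr
          _ ≤ volume (closedBall u.pos ((d + 2) * (m * h))) := by
              rw [Measure.addHaar_closedBall _ _ hh0,
                Measure.addHaar_closedBall _ _ (by positivity), ← mul_assoc]
              gcongr
              rw [← ENNReal.ofReal_natCast, ← ENNReal.ofReal_mul (by positivity)]
              refine ENNReal.ofReal_le_ofReal ?_
              have h1 : (1 : ℝ) ≤ m := by exact_mod_cast hm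
              rw [finrank_euclideanSpace_fin, ← mul_assoc ((d : ℝ) + 2), mul_pow _ h]
              refine mul_le_mul_of_nonneg_right ?_ (pow_nonneg hh0 d)
              calc (m : ℝ) = (m : ℝ) ^ 1 := (pow_one _).symm
                _ ≤ (m : ℝ) ^ d := pow_le_pow_right₀ h1 hd
                _ ≤ ((d + 2) * m : ℝ) ^ d := by
                  gcongr
                  exact le_mul_of_one_le_left (by positivity)
                    (by linarith [(Nat.cast_nonneg d : (0 : ℝ) ≤ d)])
          _ ≤ X := le_mul_of_one_le_left zero_le hd2
      exact hthin.trans (le_mul_of_one_le_left (zero_le : (0 : ℝ≥0∞) ≤ X) hn')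
    -- No volume gain here: the factor n comes from the weight of `u`, while the earlier-born
    -- neighbour has weight 1.
    · rw [mul_one]
      gcongr

/-! ### Masses of shapes and moment conditions. -/

/-- The mass `1 + ρ ^ d` controlling the volumes swept by a grain of radius `ρ`. -/
def Shape.mass (K : Shape d) : ℝ≥0∞ := ((1 + K.rad ^ d : ℝ≥0) : ℝ≥0∞)

@[fun_prop] lemma Shape.measurable_mass : Measurable (Shape.mass (d := d)) := by
  unfold Shape.mass
  fun_prop

lemma Shape.one_le_mass (K : Shape d) : 1 ≤ K.mass := by
  unfold Shape.mass
  exact_mod_cast (le_self_add : (1 : ℝ≥0) ≤ 1 + K.rad ^ d)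

lemma Shape.mass_ne_top (K : Shape d) : K.mass ≠ ∞ := ENNReal.coe_ne_top

lemma coe_pow_rad_le_mass (K : Shape d) : ((K.rad : ℝ≥0∞)) ^ d ≤ K.mass := by
  unfold Shape.mass
  exact_mod_cast (le_add_self : K.rad ^ d ≤ 1 + K.rad ^ d)

lemma volume_closedBall_eq (x : EuclideanSpace ℝ (Fin d)) (r : ℝ≥0) :
    volume (closedBall x r) =
      (r : ℝ≥0∞) ^ d * volume (ball (0 : EuclideanSpace ℝ (Fin d)) 1) := by
  rw [Measure.addHaar_closedBall _ _ r.coe_nonneg, finrank_euclideanSpace_fin,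
    ENNReal.ofReal_pow r.coe_nonneg, ENNReal.ofReal_coe_nnreal]

/-- The constant in the estimate of the volume of a ball by masses of shapes. -/
def ballConst (d : ℕ) (c : ℝ≥0) : ℝ≥0∞ :=
  ((2 * c : ℝ≥0) : ℝ≥0∞) ^ d * volume (ball (0 : EuclideanSpace ℝ (Fin d)) 1)

lemma ballConst_ne_top (c : ℝ≥0) : ballConst d c ≠ ∞ :=
  ENNReal.mul_ne_top (ENNReal.pow_ne_top ENNReal.coe_ne_top) measure_ball_lt_top.ne

lemma volume_closedBall_le (x : EuclideanSpace ℝ (Fin d)) (c : ℝ≥0) (K L : Shape d) :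
    volume (closedBall x (c * (K.rad + L.rad))) ≤ ballConst d c * (K.mass * L.mass) := by
  have h := volume_closedBall_eq x (c * (K.rad + L.rad))
  push_cast at h
  rw [h, ballConst, mul_right_comm]
  gcongr
  unfold Shape.mass
  have h1 : c * (K.rad + L.rad) ≤ 2 * c * max K.rad L.rad := by
    rw [mul_comm 2 c, mul_assoc, two_mul]
    gcongr
    exacts [le_max_left _ _, le_max_right _ _]
  have h2 : (max K.rad L.rad) ^ d ≤ (1 + K.rad ^ d) * (1 + L.rad ^ d) := by
    rcases max_choice K.rad L.rad with h | h <;> rw [h]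
    · exact le_add_self.trans (le_mul_of_one_le_right zero_le le_self_add)
    · exact le_add_self.trans (le_mul_of_one_le_left zero_le le_self_add)
  have h3 : (c * (K.rad + L.rad)) ^ d ≤ (2 * c) ^ d * ((1 + K.rad ^ d) * (1 + L.rad ^ d)) := by
    refine (pow_le_pow_left₀ zero_le h1 d).trans ?_
    rw [mul_pow]
    gcongr
  exact_mod_cast h3

section Moments

variable {Q : Measure (ℝ≥0 × Shape d)}

/-- The square is needed because a neighbour contributes its mass once through the volume of its
possible positions and once through its weight. -/
lemma lintegral_mass_sq_lt_top (hmom : ∫⁻ p, ENNReal.ofReal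
      (((p.1 : ℝ) ^ (2 * d) + 1) * (p.2.circumradius ^ (2 * d) + 1)) ∂Q < ∞) :
    ∫⁻ p, p.2.mass * p.2.mass ∂Q < ∞ := by
  refine lt_of_le_of_lt (lintegral_mono (g := fun p => ENNReal.ofReal (2 * 2 ^ (2 * d)) *
    ENNReal.ofReal (((p.1 : ℝ) ^ (2 * d) + 1) * (p.2.circumradius ^ (2 * d) + 1))) fun p => ?_) ?_
  · have h0 := p.2.circumradius_nonneg
    have h1 := p.2.rad_le
    have hr : (0 : ℝ) ≤ p.2.rad := p.2.rad.coe_nonneg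
    have hcast : p.2.mass * p.2.mass =
        ENNReal.ofReal ((1 + (p.2.rad : ℝ) ^ d) * (1 + (p.2.rad : ℝ) ^ d)) := by
      rw [Shape.mass, ← ENNReal.coe_mul, ← ENNReal.ofReal_coe_nnreal]
      push_cast
      rfl
    change p.2.mass * p.2.mass ≤ _
    beta_reduce
    rw [hcast, ← ENNReal.ofReal_mul (by positivity)]
    refine ENNReal.ofReal_le_ofReal ?_
    have h2 : ((p.2.rad : ℝ) ^ d) ^ 2 ≤ 2 ^ (2 * d) * p.2.circumradius ^ (2 * d) := by
      rw [← pow_mul, mul_comm d 2, ← mul_pow]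
      exact pow_le_pow_left₀ hr h1 _
    have h3 : (1 : ℝ) ≤ 2 ^ (2 * d) := one_le_pow₀ (by norm_num)
    have h4 : (0 : ℝ) ≤ (p.1 : ℝ) ^ (2 * d) := by positivity
    have h5 : (0 : ℝ) ≤ p.2.circumradius ^ (2 * d) := by positivity
    have h6 : (1 + (p.2.rad : ℝ) ^ d) * (1 + (p.2.rad : ℝ) ^ d) ≤
        2 * 2 ^ (2 * d) * (p.2.circumradius ^ (2 * d) + 1) := by
      nlinarith [sq_nonneg (1 - (p.2.rad : ℝ) ^ d)]
    refine h6.trans ?_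
    gcongr
    exact le_mul_of_one_le_left (by positivity) (by linarith)
  · rw [lintegral_const_mul' _ _ ENNReal.ofReal_ne_top]
    exact ENNReal.mul_lt_top ENNReal.ofReal_lt_top hmom

lemma lintegral_mass_lt_top (hmom : ∫⁻ p, ENNReal.ofReal
      (((p.1 : ℝ) ^ (2 * d) + 1) * (p.2.circumradius ^ (2 * d) + 1)) ∂Q < ∞) :
    ∫⁻ p, p.2.mass ∂Q < ∞ :=
  (lintegral_mono fun p => le_mul_of_one_le_left zero_le p.2.one_le_mass).trans_lt
    (lintegral_mass_sq_lt_top hmom)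

lemma lintegral_birth_pow_lt_top (hmom : ∫⁻ p, ENNReal.ofReal
      (((p.1 : ℝ) ^ (2 * d) + 1) * (p.2.circumradius ^ (2 * d) + 1)) ∂Q < ∞) :
    ∫⁻ p, (p.1 : ℝ≥0∞) ^ d ∂Q < ∞ := by
  refine lt_of_le_of_lt (lintegral_mono fun p => ?_) hmom
  rw [← ENNReal.ofReal_coe_nnreal, ← ENNReal.ofReal_pow p.1.coe_nonneg]
  refine ENNReal.ofReal_le_ofReal ?_
  have h0 := p.2.circumradius_nonneg
  have h1 : (p.1 : ℝ) ^ d ≤ (p.1 : ℝ) ^ (2 * d) + 1 := by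
    rw [mul_comm, pow_mul]
    nlinarith [sq_nonneg ((p.1 : ℝ) ^ d - 1), pow_nonneg p.1.coe_nonneg d]
  exact h1.trans (le_mul_of_one_le_right (by positivity) (by simp; positivity))

end Moments

/-! ### Expected numbers of paths. -/

section Chains

variable {μ : Measure (Grain d)} [SigmaFinite μ]

/-- Consecutive grains of the tuple are related by `E`. -/
def IsPath (E : Set (Grain d × Grain d)) {n : ℕ} (w : Fin (n + 1) → Grain d) : Prop :=
  ∀ i : Fin n, (w i.castSucc, w i.succ) ∈ E

lemma measurableSet_isPath {E : Set (Grain d × Grain d)} (hE : MeasurableSet E) (n : ℕ) :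
    MeasurableSet {w : Fin (n + 1) → Grain d | IsPath E w} := by
  have : {w : Fin (n + 1) → Grain d | IsPath E w} =
      ⋂ i : Fin n, (fun w => (w i.castSucc, w i.succ)) ⁻¹' E := by
    ext w
    simp [IsPath]
  rw [this]
  exact .iInter fun i => hE.preimage (by fun_prop)

lemma isPath_cons {E : Set (Grain d × Grain d)} {n : ℕ} (v : Grain d)
    (w : Fin (n + 1) → Grain d) :
    IsPath E (Fin.cons v w : Fin (n + 2) → Grain d) ↔ (v, w 0) ∈ E ∧ IsPath E w :=
  ⟨fun h => ⟨h 0, fun i => h i.succ⟩, fun h => Fin.cases h.1 h.2⟩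

/-- A Schur-type bound. Integrating out the first vertex turns `G` into a new function of the second
one, so the induction runs over all `G`; at the last vertex `W ≥ 1` suffices. -/
lemma lintegral_isPath_le {E : Set (Grain d × Grain d)} (hE : MeasurableSet E)
    {W : Grain d → ℝ≥0∞} (hW : Measurable W) (hW1 : ∀ u, 1 ≤ W u) {c : ℝ≥0∞}
    (h : ∀ u, ∫⁻ v, E.indicator 1 (u, v) * W v ∂μ ≤ c * W u) (n : ℕ) {G : Grain d → ℝ≥0∞}
    (hG : Measurable G) :
    ∫⁻ w : Fin (n + 1) → Grain d, G (w 0) * {w | IsPath E w}.indicator 1 w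
      ∂Measure.pi (fun _ => μ) ≤ c ^ n * ∫⁻ u, G u * W u ∂μ := by
  induction n generalizing G with
  | zero =>
    have h1 : ∀ w : Fin 1 → Grain d, G (w 0) * {w | IsPath E w}.indicator 1 w ≤ G (w 0) * W (w 0) := by
      intro w
      gcongr
      exact (indicator_le_self' (fun _ _ => zero_le) w).trans (hW1 _)
    refine (lintegral_mono h1).trans ?_
    rw [pow_zero, one_mul]
    exact ((measurePreserving_funUnique μ (Fin 1)).lintegral_comp (hG.mul hW)).le
  | succ n ih =>
    have hpath := measurableSet_isPath hE (n + 1)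
    have hmp := (measurePreserving_piFinSuccAbove (fun _ : Fin (n + 2) => μ) 0).symm
    refine (hmp.lintegral_comp ((hG.comp (measurable_pi_apply 0)).mul
      (measurable_one.indicator hpath))).symm.le.trans ?_
    have hEm : Measurable (E.indicator (1 : Grain d × Grain d → ℝ≥0∞)) := measurable_one.indicator hE
    have hE1 : ∀ v, Measurable fun u => E.indicator (1 : Grain d × Grain d → ℝ≥0∞) (v, u) :=
      fun v => hEm.comp measurable_prodMk_left
    have hE2 : ∀ u, Measurable fun v => E.indicator (1 : Grain d × Grain d → ℝ≥0∞) (v, u) :=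
      fun u => hEm.comp measurable_prodMk_right
    have hGE : ∀ u, Measurable fun v => G v * E.indicator (1 : Grain d × Grain d → ℝ≥0∞) (v, u) :=
      fun u => hG.mul (hE2 u)
    have hEW : ∀ v, Measurable fun u => E.indicator (1 : Grain d × Grain d → ℝ≥0∞) (v, u) * W u :=
      fun v => (hE1 v).mul hW
    have hGW : Measurable fun u => G u * W u := hG.mul hW
    have hcons : ∀ p : Grain d × (Fin (n + 1) → Grain d),
        G ((MeasurableEquiv.piFinSuccAbove (fun _ : Fin (n + 2) => Grain d) 0).symm p 0) *
          {w : Fin (n + 2) → Grain d | IsPath E w}.indicator 1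
            ((MeasurableEquiv.piFinSuccAbove (fun _ : Fin (n + 2) => Grain d) 0).symm p) =
        (G p.1 * E.indicator 1 (p.1, p.2 0)) * {w | IsPath E w}.indicator 1 p.2 := by
      rintro ⟨v, w⟩
      have he : (MeasurableEquiv.piFinSuccAbove (fun _ : Fin (n + 2) => Grain d) 0).symm (v, w) =
          (Fin.cons v w : Fin (n + 2) → Grain d) := Fin.insertNth_zero' v w
      rw [he, mul_assoc]
      congr 1
      by_cases hvw : (v, w 0) ∈ E
      · rw [indicator_of_mem hvw, Pi.one_apply, one_mul]
        change _ = {w | IsPath E w}.indicator (1 : (Fin (n + 1) → Grain d) → ℝ≥0∞) w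
        by_cases hw : IsPath E w
        · rw [indicator_of_mem (s := {w | IsPath E w}) hw]
          exact indicator_of_mem (show _ ∈ {w : Fin (n + 2) → Grain d | IsPath E w} from
            (isPath_cons v w).2 ⟨hvw, hw⟩) _
        · rw [indicator_of_notMem (s := {w | IsPath E w}) hw]
          exact indicator_of_notMem (show _ ∉ {w : Fin (n + 2) → Grain d | IsPath E w} from
            fun h => hw ((isPath_cons v w).1 h).2) _
      · rw [indicator_of_notMem hvw, zero_mul]
        exact indicator_of_notMem (show _ ∉ {w : Fin (n + 2) → Grain d | IsPath E w} from
          fun h => hvw ((isPath_cons v w).1 h).1) _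
    have hm : Measurable fun p : Grain d × (Fin (n + 1) → Grain d) =>
        (G p.1 * E.indicator 1 (p.1, p.2 0)) * {w | IsPath E w}.indicator 1 p.2 := by
      refine ((hG.comp measurable_fst).mul (hEm.comp (by fun_prop))).mul ?_
      exact (measurable_one.indicator (measurableSet_isPath hE n)).comp measurable_snd
    have hG' : Measurable fun u => ∫⁻ v, G v * E.indicator 1 (v, u) ∂μ :=
      Measurable.lintegral_prod_left' (f := fun q : Grain d × Grain d => G q.1 * E.indicator 1 q)
        ((hG.comp measurable_fst).mul hEm)
    calc _ = ∫⁻ p : Grain d × (Fin (n + 1) → Grain d),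
          (G p.1 * E.indicator 1 (p.1, p.2 0)) * {w | IsPath E w}.indicator 1 p.2
            ∂(μ.prod (Measure.pi fun _ => μ)) := lintegral_congr hcons
      _ = ∫⁻ w : Fin (n + 1) → Grain d, (∫⁻ v, G v * E.indicator 1 (v, w 0) ∂μ) *
            {w | IsPath E w}.indicator 1 w ∂Measure.pi (fun _ => μ) := by
          rw [lintegral_prod_symm' _ hm]
          refine lintegral_congr fun w => ?_
          exact lintegral_mul_const ({w | IsPath E w}.indicator 1 w) (hGE (w 0))
      _ ≤ c ^ n * ∫⁻ u, (∫⁻ v, G v * E.indicator 1 (v, u) ∂μ) * W u ∂μ := ih hG'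
      _ = c ^ n * ∫⁻ v, G v * ∫⁻ u, E.indicator 1 (v, u) * W u ∂μ ∂μ := by
          congr 1
          have e1 : ∀ u, (∫⁻ v, G v * E.indicator 1 (v, u) ∂μ) * W u =
              ∫⁻ v, G v * E.indicator 1 (v, u) * W u ∂μ := fun u =>
            (lintegral_mul_const _ (hGE u)).symm
          have e2 : ∀ v, G v * ∫⁻ u, E.indicator 1 (v, u) * W u ∂μ =
              ∫⁻ u, G v * E.indicator 1 (v, u) * W u ∂μ := fun v => by
            rw [← lintegral_const_mul _ (hEW v)]
            simp only [mul_assoc]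
          simp_rw [e1, e2]
          refine lintegral_lintegral_swap (Measurable.aemeasurable ?_)
          exact ((hG.comp measurable_snd).mul (hEm.comp measurable_swap)).mul (hW.comp measurable_fst)
      _ ≤ c ^ n * ∫⁻ v, G v * (c * W v) ∂μ := by
          gcongr with v
          exact h v
      _ = c ^ (n + 1) * ∫⁻ u, G u * W u ∂μ := by
          have e3 : ∀ v, G v * (c * W v) = c * (G v * W v) := fun v => mul_left_comm _ _ _
          simp_rw [e3]
          rw [lintegral_const_mul _ hGW, pow_succ, mul_assoc]

end Chains

/-! ### Almost sure finiteness and absence of infinite paths. -/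

/-- The factorial moment measures are bounded by those of a marked Poisson process. -/
def MomentBound {Ω : Type*} [MeasurableSpace Ω] (P : Measure Ω) (Ψ : Ω → Config d) (a : ℝ≥0∞)
    (Q : Measure (ℝ≥0 × Shape d)) : Prop :=
  ∀ k : ℕ, 1 ≤ k → ∀ C : Set (Fin k → Grain d), MeasurableSet C →
    factorialMoment P Ψ k C ≤ a ^ k * Measure.pi (fun _ : Fin k =>
      (volume : Measure (EuclideanSpace ℝ (Fin d))).prod Q) C

lemma measurableSet_norm_pos_le (B : ℕ) : MeasurableSet {u : Grain d | ‖u.pos‖ ≤ B} :=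
  measurableSet_le (by fun_prop) measurable_const

section

variable {Q : Measure (ℝ≥0 × Shape d)} [SFinite Q]

/-- The integral over a grain is an integral over its position followed by one over its mark. -/
lemma lintegral_grain {f : Grain d → ℝ≥0∞} (hf : Measurable f) :
    ∫⁻ u, f u ∂(volume : Measure (EuclideanSpace ℝ (Fin d))).prod Q =
      ∫⁻ p, (∫⁻ x, f (x, p)) ∂Q :=
  lintegral_prod_symm' _ hf

lemma lintegral_ball_mul {F : ℝ≥0 × Shape d → ℝ≥0∞} (hF : Measurable F) (B : ℕ) :
    ∫⁻ u : Grain d, {u : Grain d | ‖u.pos‖ ≤ B}.indicator 1 u * F u.2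
      ∂(volume : Measure (EuclideanSpace ℝ (Fin d))).prod Q =
      volume (closedBall (0 : EuclideanSpace ℝ (Fin d)) B) * ∫⁻ p, F p ∂Q := by
  have h := lintegral_prod_mul (μ := (volume : Measure (EuclideanSpace ℝ (Fin d)))) (ν := Q)
    (f := (closedBall (0 : EuclideanSpace ℝ (Fin d)) B).indicator 1) (g := F)
    (measurable_one.indicator measurableSet_closedBall).aemeasurable hF.aemeasurable
  rw [lintegral_indicator_one measurableSet_closedBall] at h
  rw [← h]
  refine lintegral_congr fun u => ?_
  congr 1
  classical
  simp only [indicator_apply, mem_ofPred_eq, mem_closedBall_zero_iff]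
  rfl

end

section

variable {Ω : Type*} [MeasurableSpace Ω] {P : Measure Ω} {Ψ : Ω → Config d} {a : ℝ≥0∞}
  {Q : Measure (ℝ≥0 × Shape d)} [IsProbabilityMeasure Q]

lemma measure_related_pairs_lt_top {S : Set (Grain d × Grain d)} (hS : MeasurableSet S)
    {F G : ℝ≥0 × Shape d → ℝ≥0∞} (hF : Measurable F) (hG : Measurable G)
    (hF' : ∫⁻ p, F p ∂Q ≠ ∞) (hG' : ∫⁻ p, G p ∂Q ≠ ∞)
    (hvol : ∀ (u : Grain d) (p : ℝ≥0 × Shape d), volume {x | (u, ((x, p) : Grain d)) ∈ S} ≤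
      F u.2 * G p) (B : ℕ) :
    ((volume : Measure (EuclideanSpace ℝ (Fin d))).prod Q).prod
      ((volume : Measure (EuclideanSpace ℝ (Fin d))).prod Q)
      {q : Grain d × Grain d | ‖q.1.pos‖ ≤ B ∧ q ∈ S} < ∞ := by
  set C' : Set (Grain d × Grain d) := {q | ‖q.1.pos‖ ≤ B ∧ q ∈ S}
  have hC' : MeasurableSet C' := ((measurableSet_norm_pos_le B).preimage measurable_fst).inter hS
  have hinner : ∀ u : Grain d, (volume : Measure (EuclideanSpace ℝ (Fin d))).prod Q
      {v | (u, v) ∈ S} ≤ F u.2 * ∫⁻ p, G p ∂Q := by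
    intro u
    have hSu : MeasurableSet {v | (u, v) ∈ S} := hS.preimage measurable_prodMk_left
    rw [Measure.prod_apply_symm hSu, ← lintegral_const_mul _ hG]
    exact lintegral_mono fun p => hvol u p
  rw [Measure.prod_apply hC']
  refine lt_of_le_of_lt (lintegral_mono (g := fun u : Grain d =>
    {u : Grain d | ‖u.pos‖ ≤ B}.indicator 1 u * (F u.2 * ∫⁻ p, G p ∂Q)) fun u : Grain d => ?_) ?_
  · by_cases hu : ‖u.pos‖ ≤ B
    · beta_reduce
      rw [indicator_of_mem (show u ∈ {u : Grain d | ‖u.pos‖ ≤ B} from hu), Pi.one_apply, one_mul]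
      exact (measure_mono fun v hv => hv.2).trans (hinner u)
    · have : Prod.mk u ⁻¹' C' = ∅ := eq_empty_of_forall_notMem fun v hv => hu hv.1
      rw [this, measure_empty]
      exact zero_le
  · rw [lintegral_ball_mul (F := fun p => F p * ∫⁻ p, G p ∂Q) (hF.mul_const _) B,
      lintegral_mul_const' _ _ hG']
    exact ENNReal.mul_lt_top measure_closedBall_lt_top (ENNReal.mul_lt_top hF'.lt_top hG'.lt_top)

/-- If the expected number of grains related to a given grain is finite, then almost surely all
grains are related to finitely many grains. -/
lemma ae_finite_related (hΨ : Measurable Ψ) (ha : a ≠ ∞) (hM : MomentBound P Ψ a Q)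
    {S : Set (Grain d × Grain d)} (hS : MeasurableSet S) {F G : ℝ≥0 × Shape d → ℝ≥0∞}
    (hF : Measurable F) (hG : Measurable G) (hF' : ∫⁻ p, F p ∂Q ≠ ∞) (hG' : ∫⁻ p, G p ∂Q ≠ ∞)
    (hvol : ∀ (u : Grain d) (p : ℝ≥0 × Shape d), volume {x | (u, ((x, p) : Grain d)) ∈ S} ≤
      F u.2 * G p) :
    ∀ᵐ ω ∂P, ∀ u ∈ (Ψ ω).carrier, {v ∈ (Ψ ω).carrier | v ≠ u ∧ (u, v) ∈ S}.Finite := by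
  set C : ℕ → Set (Fin 2 → Grain d) := fun B =>
    (fun w => (w 0, w 1)) ⁻¹' {q : Grain d × Grain d | ‖q.1.pos‖ ≤ B ∧ q ∈ S}
  have hC' : ∀ B : ℕ, MeasurableSet {q : Grain d × Grain d | ‖q.1.pos‖ ≤ B ∧ q ∈ S} := fun B =>
    ((measurableSet_norm_pos_le B).preimage measurable_fst).inter hS
  have hC : ∀ B, MeasurableSet (C B) := by
    intro B
    have h01 : Measurable fun w : Fin 2 → Grain d => (w 0, w 1) :=
      (measurable_pi_apply 0).prodMk (measurable_pi_apply 1)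
    exact (hC' B).preimage h01
  -- The second factorial moment bounds the expected number of related pairs whose first grain lies
  -- in a given ball.
  have hfin : ∀ B, Measure.pi (fun _ : Fin 2 =>
      (volume : Measure (EuclideanSpace ℝ (Fin d))).prod Q) (C B) < ∞ := by
    intro B
    have hmp : MeasurePreserving (fun w : Fin 2 → Grain d => (w 0, w 1)) _ _ :=
      measurePreserving_finTwoArrow ((volume : Measure (EuclideanSpace ℝ (Fin d))).prod Q)
    have h1 := hmp.measure_preimage (hC' B).nullMeasurableSet
    exact lt_of_eq_of_lt h1 (measure_related_pairs_lt_top hS hF hG hF' hG' hvol B)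
  have hae : ∀ B : ℕ, ∀ᵐ ω ∂P, {w : Fin 2 → Grain d | Function.Injective w ∧
      (∀ i, w i ∈ (Ψ ω).carrier) ∧ w ∈ C B}.Finite := by
    intro B
    have h1 := ae_lt_top ((measurable_encard_tuples 2 (hC B)).comp hΨ)
      (((hM 2 (by norm_num) _ (hC B)).trans_lt
        (ENNReal.mul_lt_top (ENNReal.pow_lt_top ha.lt_top) (hfin B))).ne)
    filter_upwards [h1] with ω hω
    rw [Function.comp_apply, ENat.toENNReal_lt_top] at hω
    exact Set.encard_lt_top_iff.1 hω
  filter_upwards [ae_all_iff.2 hae] with ω hω u hu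
  obtain ⟨B, hB⟩ := exists_nat_ge ‖u.pos‖
  refine Set.Finite.of_finite_image (f := fun v => ![u, v]) ((hω B).subset ?_) ?_
  · rintro _ ⟨v, ⟨hv, hvu, hvS⟩, rfl⟩
    refine ⟨?_, ?_, hB, hvS⟩
    · intro i j hij
      fin_cases i <;> fin_cases j <;> simp_all
    · intro i
      fin_cases i
      exacts [hu, hv]
  · intro v _ v' _ h
    exact congrFun h 1

lemma measurableSet_windowEdge (b c : ℝ≥0) {α : Type*} [MeasurableSpace α] {f g : α → Grain d}
    (hf : Measurable f) (hg : Measurable g) : MeasurableSet {x | WindowEdge b c (f x) (g x)} := by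
  have hm : Measurable fun x => (f x).meetTime (g x) := hf.meetTime hg
  exact (measurableSet_lt measurable_const hm).inter
    ((measurableSet_le hm measurable_const).inter (Grain.measurableSet_covers hf hg).compl)

lemma measurable_windowWeight (b : ℝ≥0) (n : ℕ) : Measurable (windowWeight b n) :=
  Measurable.ite measurableSet_Ioi measurable_const measurable_const

lemma one_le_windowWeight (b : ℝ≥0) {n : ℕ} (hn : 1 ≤ n) (t : ℝ≥0) : 1 ≤ windowWeight b n t := by
  unfold windowWeight
  split_ifs
  exacts [by exact_mod_cast hn, le_rfl]

lemma windowWeight_le (b : ℝ≥0) {n : ℕ} (hn : 1 ≤ n) (t : ℝ≥0) : windowWeight b n t ≤ n := by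
  unfold windowWeight
  split_ifs
  exacts [le_rfl, by exact_mod_cast hn]

/-- The constant in the estimate of the expected number of paths. -/
def pathConst (Q : Measure (ℝ≥0 × Shape d)) (L : ℝ≥0) : ℝ≥0∞ :=
  2 * d * ballConst d ((d + 2) * L) * ∫⁻ p, p.2.mass * p.2.mass ∂Q

/-- With `n² * ε` fixed, the constant is of order 1/n; this is the ratio of the geometric bound. -/
lemma lintegral_windowEdge_le (hd : 0 < d) {b ε : ℝ≥0} {n : ℕ} (hn : 1 ≤ n)
    (hb : b + ε ≤ (n ^ 2 : ℕ) * ε) (u : Grain d) :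
    ∫⁻ v : Grain d, {q : Grain d × Grain d | WindowEdge b (b + ε) q.1 q.2}.indicator 1 (u, v) *
      (windowWeight b n v.birth * v.shape.mass)
        ∂(volume : Measure (EuclideanSpace ℝ (Fin d))).prod Q ≤
      pathConst Q ((n ^ 2 : ℕ) * ε) / n * (windowWeight b n u.birth * u.shape.mass) := by
  set E := {q : Grain d × Grain d | WindowEdge b (b + ε) q.1 q.2}
  have hE : MeasurableSet E := measurableSet_windowEdge b (b + ε) measurable_fst measurable_snd
  have hn0 : (n : ℝ≥0∞) ≠ 0 := by
    have : n ≠ 0 := by omega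
    exact_mod_cast this
  have hE1 : Measurable fun v => E.indicator (1 : Grain d × Grain d → ℝ≥0∞) (u, v) :=
    (measurable_one.indicator hE).comp measurable_prodMk_left
  have hEW : Measurable fun v => E.indicator (1 : Grain d × Grain d → ℝ≥0∞) (u, v) *
      (windowWeight b n v.birth * v.shape.mass) :=
    hE1.mul (((measurable_windowWeight b n).comp Grain.measurable_birth).mul
      (Shape.measurable_mass.comp Grain.measurable_shape))
  rw [← ENNReal.mul_le_mul_iff_right hn0 (ENNReal.natCast_ne_top n)]
  rw [← lintegral_const_mul _ hEW, lintegral_grain (hEW.const_mul _)]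
  set X : ℝ≥0∞ := windowWeight b n u.birth * (2 * d * ballConst d ((d + 2) * ((n ^ 2 : ℕ) * ε)) *
    u.shape.mass) with hX
  have hXtop : X ≠ ∞ := by
    refine ENNReal.mul_ne_top (ne_top_of_le_ne_top (ENNReal.natCast_ne_top n)
      (windowWeight_le b hn _)) (ENNReal.mul_ne_top (ENNReal.mul_ne_top ?_
        (ballConst_ne_top _)) u.shape.mass_ne_top)
    exact ENNReal.mul_ne_top (by simp) (ENNReal.natCast_ne_top d)
  calc _ ≤ ∫⁻ p, X * (p.2.mass * p.2.mass) ∂Q := by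
        refine lintegral_mono fun p => ?_
        have hSm : MeasurableSet {x : EuclideanSpace ℝ (Fin d) |
            WindowEdge b (b + ε) u (x, p)} := 
          measurableSet_windowEdge b (b + ε) measurable_const measurable_prodMk_right
        have h1 : ∫⁻ x : EuclideanSpace ℝ (Fin d), (n : ℝ≥0∞) *
            (E.indicator 1 (u, ((x, p) : Grain d)) *
              (windowWeight b n (Grain.birth (x, p)) * (Grain.shape (x, p)).mass)) =
            (n * windowWeight b n p.1 * volume {x | WindowEdge b (b + ε) u (x, p.1, p.2)}) *
              p.2.mass := by
          have e1 : ∀ x : EuclideanSpace ℝ (Fin d), (n : ℝ≥0∞) *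
            (E.indicator 1 (u, ((x, p) : Grain d)) *
              (windowWeight b n (Grain.birth (x, p)) * (Grain.shape (x, p)).mass)) =
              {x : EuclideanSpace ℝ (Fin d) | WindowEdge b (b + ε) u (x, p)}.indicator 1 x *
                (n * windowWeight b n p.1 * p.2.mass) := by
            intro x
            change (n : ℝ≥0∞) * ({x : EuclideanSpace ℝ (Fin d) |
              WindowEdge b (b + ε) u (x, p)}.indicator 1 x * (windowWeight b n p.1 * p.2.mass)) = _
            ring
          simp_rw [e1]
          rw [lintegral_mul_const _ (measurable_one.indicator hSm), lintegral_indicator_one hSm]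
          ring
        have h4 := natCast_mul_volume_windowEdge_le hd u p.1 p.2 hn hb
        rw [h1]
        have h2 := volume_closedBall_le u.pos ((d + 2) * ((n ^ 2 : ℕ) * ε)) u.shape p.2
        have h3 : ((d : ℝ) + 2) * (((n ^ 2 : ℕ) : ℝ) * (ε * (u.shape.rad + p.2.rad))) =
            (((d + 2) * ((n ^ 2 : ℕ) * ε) : ℝ≥0) : ℝ) * (u.shape.rad + p.2.rad) := by
          push_cast; ring
        rw [h3] at h4
        calc _ ≤ windowWeight b n u.birth * (2 * d * volume (closedBall u.pos
              ((((d + 2) * ((n ^ 2 : ℕ) * ε) : ℝ≥0) : ℝ) * (u.shape.rad + p.2.rad)))) *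
                p.2.mass := by gcongr
          _ ≤ windowWeight b n u.birth * (2 * d * (ballConst d ((d + 2) * ((n ^ 2 : ℕ) * ε)) *
              (u.shape.mass * p.2.mass))) * p.2.mass := by gcongr
          _ = _ := by rw [hX]; ring
    _ = X * ∫⁻ p, p.2.mass * p.2.mass ∂Q := lintegral_const_mul' _ _ hXtop
    _ = pathConst Q ((n ^ 2 : ℕ) * ε) * (windowWeight b n u.birth * u.shape.mass) := by
        rw [hX, pathConst]; ring
    _ = n * (pathConst Q ((n ^ 2 : ℕ) * ε) / n *
          (windowWeight b n u.birth * u.shape.mass)) := by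
        rw [← mul_assoc (n : ℝ≥0∞), ENNReal.mul_div_cancel hn0 (ENNReal.natCast_ne_top n)]

/-- If the expected number of successors of a grain is small, then there are no infinite paths. -/
lemma ae_not_exists_path (hΨ : Measurable Ψ) (hM : MomentBound P Ψ a Q)
    {E : Set (Grain d × Grain d)} (hE : MeasurableSet E) {W : Grain d → ℝ≥0∞} (hW : Measurable W)
    (hW1 : ∀ u, 1 ≤ W u) {c : ℝ≥0∞} (ha : a ≠ ∞) (hc : a * c < 1)
    (h : ∀ u, ∫⁻ v, E.indicator 1 (u, v) * W v
      ∂(volume : Measure (EuclideanSpace ℝ (Fin d))).prod Q ≤ c * W u)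
    (hfin : ∀ B : ℕ, ∫⁻ u, {u : Grain d | ‖u.pos‖ ≤ B}.indicator 1 u * W u
      ∂(volume : Measure (EuclideanSpace ℝ (Fin d))).prod Q ≠ ∞) :
    ∀ᵐ ω ∂P, ¬ ∃ p : ℕ → Grain d, Function.Injective p ∧ (∀ i, p i ∈ (Ψ ω).carrier) ∧
      ∀ i, (p i, p (i + 1)) ∈ E := by
  set C : ℕ → ∀ n : ℕ, Set (Fin (n + 1) → Grain d) := fun B n =>
    {w | ‖(w 0).pos‖ ≤ B ∧ IsPath E w}
  have hC : ∀ B n, MeasurableSet (C B n) := by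
    intro B n
    have h0 : Measurable fun w : Fin (n + 1) → Grain d => w 0 := measurable_pi_apply 0
    exact ((measurableSet_norm_pos_le B).preimage h0).inter (measurableSet_isPath hE n)
  set N : ℕ → ℕ → Ω → ℝ≥0∞ := fun B n ω => (({w : Fin (n + 1) → Grain d |
    Function.Injective w ∧ (∀ i, w i ∈ (Ψ ω).carrier) ∧ w ∈ C B n}.encard : ℕ∞) : ℝ≥0∞)
  have hN : ∀ B n, Measurable (N B n) := fun B n =>
    (measurable_encard_tuples (n + 1) (hC B n)).comp hΨ
  -- Markov's inequality for the number of paths with `n` edges starting in the ball.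
  have hbound : ∀ B n, P {ω | 1 ≤ N B n ω} ≤ (a * c) ^ n *
      (a * ∫⁻ u, {u : Grain d | ‖u.pos‖ ≤ B}.indicator 1 u * W u
        ∂(volume : Measure (EuclideanSpace ℝ (Fin d))).prod Q) := by
    intro B n
    have h1 := mul_meas_ge_le_lintegral (μ := P) (hN B n) 1
    rw [one_mul] at h1
    refine h1.trans ((hM (n + 1) (by omega) _ (hC B n)).trans ?_)
    have h2 := lintegral_isPath_le hE hW hW1 h n (G := {u : Grain d | ‖u.pos‖ ≤ B}.indicator 1)
      (measurable_one.indicator (measurableSet_norm_pos_le B))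
    have h3 : Measure.pi (fun _ : Fin (n + 1) =>
        (volume : Measure (EuclideanSpace ℝ (Fin d))).prod Q) (C B n) =
        ∫⁻ w : Fin (n + 1) → Grain d, {u : Grain d | ‖u.pos‖ ≤ B}.indicator 1 (w 0) *
          {w | IsPath E w}.indicator 1 w ∂Measure.pi (fun _ =>
            (volume : Measure (EuclideanSpace ℝ (Fin d))).prod Q) := by
      rw [← lintegral_indicator_one (hC B n)]
      refine lintegral_congr fun w => ?_
      exact congrFun (inter_indicator_one (M₀ := ℝ≥0∞)
        (s := {w : Fin (n + 1) → Grain d | ‖(w 0).pos‖ ≤ B})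
        (t := {w : Fin (n + 1) → Grain d | IsPath E w})) w
    rw [h3]
    calc _ ≤ a ^ (n + 1) * (c ^ n * _) := mul_le_mul_right h2 _
      _ = _ := by rw [mul_pow, pow_succ]; ring
  have hzero : ∀ B, P {ω | ∀ n, 1 ≤ N B n ω} = 0 := by
    intro B
    have hlim : Tendsto (fun n => (a * c) ^ n *
      (a * ∫⁻ u, {u : Grain d | ‖u.pos‖ ≤ B}.indicator 1 u * W u
        ∂(volume : Measure (EuclideanSpace ℝ (Fin d))).prod Q)) atTop (𝓝 (0 * _)) :=
      ENNReal.Tendsto.mul_const (ENNReal.tendsto_pow_atTop_nhds_zero_of_lt_one hc)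
        (Or.inr (ENNReal.mul_ne_top ha (hfin B)))
    rw [zero_mul] at hlim
    refine le_antisymm (ge_of_tendsto' hlim fun n => ?_) zero_le
    refine le_trans (measure_mono ?_) (hbound B n)
    exact fun ω (hω : ∀ n, 1 ≤ N B n ω) => hω n
  have hae : ∀ B : ℕ, ∀ᵐ ω ∂P, ¬ ∀ n, 1 ≤ N B n ω := by
    intro B
    rw [ae_iff]
    simpa only [not_not] using hzero B
  filter_upwards [ae_all_iff.2 hae] with ω hω
  rintro ⟨p, hp, hpA, hpE⟩
  obtain ⟨B, hB⟩ := exists_nat_ge ‖(p 0).pos‖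
  refine hω B fun n => ?_
  have hmem : (fun i : Fin (n + 1) => p i) ∈ {w : Fin (n + 1) → Grain d |
      Function.Injective w ∧ (∀ i, w i ∈ (Ψ ω).carrier) ∧ w ∈ C B n} := by
    refine ⟨fun i j hij => Fin.ext (hp hij), fun i => hpA i, hB, fun i => hpE i⟩
  have h1 : 1 ≤ {w : Fin (n + 1) → Grain d |
      Function.Injective w ∧ (∀ i, w i ∈ (Ψ ω).carrier) ∧ w ∈ C B n}.encard :=
    Set.one_le_encard_iff_nonempty.2 ⟨_, hmem⟩
  have h2 : ((1 : ℕ∞) : ℝ≥0∞) ≤ N B n ω := ENat.toENNReal_le.2 h1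
  rwa [ENat.toENNReal_one] at h2

lemma exists_ae_not_exists_windowPath (hd : 0 < d) (hΨ : Measurable Ψ) (ha : a ≠ ∞)
    (hM : MomentBound P Ψ a Q) (hmass : ∫⁻ p, p.2.mass ∂Q ≠ ∞)
    (hmass2 : ∫⁻ p, p.2.mass * p.2.mass ∂Q ≠ ∞) (M : ℕ) :
    ∃ ε : ℝ≥0, 0 < ε ∧ ∀ᵐ ω ∂P, ∀ j : ℕ, j * ε ≤ M → ¬ ∃ p : ℕ → Grain d,
      Function.Injective p ∧ (∀ i, p i ∈ (Ψ ω).carrier) ∧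
        ∀ i, WindowEdge (j * ε) ((j + 1) * ε) (p i) (p (i + 1)) := by
  -- The length `L = n² * ε` is fixed before `n`, so the constant does not depend on `n`. It bounds
  -- every window end: `j * ε ≤ M` and `ε ≤ M + 2`, since `n ≥ 2`.
  set L : ℝ≥0 := 2 * (M + 1)
  have hconst : a * pathConst Q L ≠ ∞ := by
    refine ENNReal.mul_ne_top ha (ENNReal.mul_ne_top (ENNReal.mul_ne_top ?_
      (ballConst_ne_top _)) hmass2)
    exact ENNReal.mul_ne_top (by simp) (ENNReal.natCast_ne_top d)
  obtain ⟨k, hk⟩ := ENNReal.exists_nat_gt hconst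
  set n : ℕ := k + 2
  have hn : 1 ≤ n := by omega
  have hn2 : (0 : ℝ≥0) < (n ^ 2 : ℕ) := by positivity
  set ε : ℝ≥0 := L / (n ^ 2 : ℕ)
  have hεL : (n ^ 2 : ℕ) * ε = L := mul_div_cancel₀ _ hn2.ne'
  refine ⟨ε, div_pos (by positivity) hn2, ae_all_iff.2 fun j => ?_⟩
  by_cases hj : j * ε ≤ M
  swap
  · exact Eventually.of_forall fun ω h => absurd h hj
  have hb : (j * ε : ℝ≥0) + ε ≤ (n ^ 2 : ℕ) * ε := by
    rw [hεL]
    have h4 : (4 : ℝ≥0) ≤ (n ^ 2 : ℕ) := by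
      have : 2 ^ 2 ≤ n ^ 2 := Nat.pow_le_pow_left (by omega) 2
      exact_mod_cast this
    have h1 : ε ≤ M + 2 := by
      have h5 : ε ≤ L / 4 := div_le_div_of_nonneg_left zero_le (by norm_num) h4
      refine h5.trans ?_
      rw [div_le_iff₀ (by norm_num)]
      simp only [L]
      have : (0 : ℝ≥0) ≤ M := zero_le
      nlinarith
    calc (j * ε : ℝ≥0) + ε ≤ M + (M + 2) := add_le_add hj h1
      _ = L := by simp only [L]; ring
  have hc : a * (pathConst Q L / n) < 1 := by
    rw [← mul_div_assoc]
    refine ENNReal.div_lt_of_lt_mul ?_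
    rw [one_mul]
    refine hk.trans_le ?_
    exact_mod_cast (by omega : k ≤ n)
  have hpath := ae_not_exists_path hΨ hM (measurableSet_windowEdge (j * ε) (j * ε + ε)
      measurable_fst measurable_snd)
    (W := fun v => windowWeight (j * ε) n v.birth * v.shape.mass)
    (((measurable_windowWeight _ n).comp Grain.measurable_birth).mul
      (Shape.measurable_mass.comp Grain.measurable_shape))
    (fun u => one_le_mul (one_le_windowWeight _ hn _) u.shape.one_le_mass) ha hc
    (fun u => by
      have := lintegral_windowEdge_le (Q := Q) hd hn hb u
      rwa [hεL] at this)
    (fun B => by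
      refine ne_top_of_le_ne_top (b := volume (closedBall (0 : EuclideanSpace ℝ (Fin d)) B) *
        ∫⁻ p, n * p.2.mass ∂Q) ?_ ?_
      · rw [lintegral_const_mul' _ _ (ENNReal.natCast_ne_top n)]
        exact ENNReal.mul_ne_top measure_closedBall_lt_top.ne
          (ENNReal.mul_ne_top (ENNReal.natCast_ne_top n) hmass)
      · rw [← lintegral_ball_mul (Q := Q) (F := fun p => (n : ℝ≥0∞) * p.2.mass) (by fun_prop) B]
        refine lintegral_mono fun u : Grain d => ?_
        have hw := windowWeight_le (j * ε) hn u.birth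
        change _ * (_ * u.shape.mass) ≤ _ * (n * u.shape.mass)
        gcongr)
  filter_upwards [hpath] with ω hω _
  rintro ⟨p, hp1, hp2, hp3⟩
  refine hω ⟨p, hp1, hp2, fun i => ?_⟩
  have h3 := hp3 i
  rw [add_mul, one_mul] at h3
  exact h3

end

/-! ### Growth times of the model. -/

lemma birth_le_nextEnd (A : Set (Grain d)) (s : Grain d → ℝ≥0∞) (u : Grain d) :
    (u.birth : ℝ≥0∞) ≤ nextEnd A s u := by
  refine le_of_forall_gt fun c hc => ?_
  obtain ⟨v, -, -, -, y, -, hlt⟩ := nextEnd_lt_iff.1 hc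
  refine lt_of_le_of_lt ?_ hlt
  exact_mod_cast (u.birth_le_arrival y).trans (le_max_left _ _)

/-- The growth time of a grain in the growth-maximal model. -/
def growthTime (p : Config d × Grain d) : ℝ≥0 :=
  (endTime p.1.carrier p.2).toNNReal - p.2.birth

lemma measurable_growthTime : Measurable (growthTime (d := d)) :=
  measurable_endTime.ennreal_toNNReal.sub (Grain.measurable_birth.comp measurable_snd)

lemma growthTime_spec (hd : 0 < d) (ψ : Config d) (hinf : ψ.carrier.Infinite)
    (hwf : WellFounded (Precedes ψ.carrier))
    (hfin : ∀ u ∈ ψ.carrier, ∀ c, {v ∈ ψ.carrier | u.meetTime v ≤ c}.Finite)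
    (hcov : ∀ u ∈ ψ.carrier, {v ∈ ψ.carrier | u.Covers v}.Finite) :
    IsGrowthMaximal (fun u : ψ.carrier => (u : Grain d)) (fun u => growthTime (ψ, u)) ∧
      ∀ r : ψ.carrier → ℝ≥0, IsGrowthMaximal (fun u : ψ.carrier => (u : Grain d)) r →
        ∀ u : ψ.carrier, r u = growthTime (ψ, u) := by
  have hfix : ∀ u ∈ ψ.carrier, endTime ψ.carrier u = nextEnd ψ.carrier (endTime ψ.carrier) u :=
    fun u hu => endTime_eq_nextEnd hwf hfin hu
  have hR : ∀ u : ψ.carrier, endTime ψ.carrier u =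
      ((u : Grain d).birth + growthTime (ψ, (u : Grain d)) : ℝ≥0) := by
    intro u
    -- Finite end times not before birth: neither `toNNReal` nor the truncated subtraction in
    -- `growthTime` loses anything.
    have htop := endTime_ne_top hinf ψ.pos_ne hcov hfix u.2
    have hle : ((u : Grain d).birth : ℝ≥0∞) ≤ endTime ψ.carrier u := by
      rw [hfix u u.2]
      exact birth_le_nextEnd _ _ _
    have hle' : (u : Grain d).birth ≤ (endTime ψ.carrier (u : Grain d)).toNNReal :=
      ENNReal.le_toNNReal_of_coe_le hle htop
    rw [growthTime, add_tsub_cancel_of_le hle', ENNReal.coe_toNNReal htop]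
  refine ⟨isGrowthMaximal_of_eq_nextEnd hd ψ.pos_ne hfin hR hfix, fun r hr u => ?_⟩
  classical
  -- The value 0 off the configuration is arbitrary; the fixed point equation only sees grains of
  -- the configuration.
  set s : Grain d → ℝ≥0∞ := fun v =>
    if hv : v ∈ ψ.carrier then ((v.birth + r ⟨v, hv⟩ : ℝ≥0) : ℝ≥0∞) else 0
  have hs : ∀ v : ψ.carrier, s v = ((v : Grain d).birth + r v : ℝ≥0) := fun v => dif_pos v.2
  have h := eq_endTime_of_eq_nextEnd hwf hfin (hr.eq_nextEnd hd ψ.pos_ne hs) u.2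
  rw [hs, hR] at h
  exact add_left_cancel (ENNReal.coe_injective h)

lemma IsGrowthMaximal.comp_equiv {ι κ : Type*} {u : ι → Grain d} {r : ι → ℝ≥0}
    (h : IsGrowthMaximal u r) (e : κ ≃ ι) : IsGrowthMaximal (u ∘ e) (r ∘ e) := by
  refine ⟨fun m n hmn => h.hardCore _ _ (e.injective.ne hmn), fun m hm => ?_, fun m hm => ?_⟩
  · obtain ⟨n, hn, hn'⟩ := h.earlier_of_zero (e m) hm
    refine ⟨e.symm n, fun he => hn (by rw [← he, e.apply_symm_apply]), ?_⟩
    simpa using hn'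
  · obtain ⟨n, hn, hn'⟩ := h.earlier_of_pos (e m) hm
    refine ⟨e.symm n, fun he => hn (by rw [← he, e.apply_symm_apply]), ?_⟩
    simpa using hn'

lemma exists_equiv_of_range_eq {α : Type*} {A : Set α} {g : ℕ → α} (hg : Function.Injective g)
    (hA : Set.range g = A) : ∃ e : ℕ ≃ A, ∀ n, (e n : α) = g n := by
  subst hA
  exact ⟨Equiv.ofInjective g hg, fun n => rfl⟩

/-! ### Almost sure verification of the deterministic conditions. -/

section

variable {Ω : Type*} [MeasurableSpace Ω] {P : Measure Ω} {Ψ : Ω → Config d} {a : ℝ≥0∞}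
  {Q : Measure (ℝ≥0 × Shape d)} [IsProbabilityMeasure Q]

lemma ae_finite_meetTime_le (hΨ : Measurable Ψ) (ha : a ≠ ∞) (hM : MomentBound P Ψ a Q)
    (hmass : ∫⁻ p, p.2.mass ∂Q ≠ ∞) :
    ∀ᵐ ω ∂P, ∀ u ∈ (Ψ ω).carrier, ∀ c, {v ∈ (Ψ ω).carrier | u.meetTime v ≤ c}.Finite := by
  have h : ∀ c : ℕ, ∀ᵐ ω ∂P, ∀ u ∈ (Ψ ω).carrier,
      {v ∈ (Ψ ω).carrier | v ≠ u ∧ (u, v) ∈ {q : Grain d × Grain d | q.1.meetTime q.2 ≤ c}}.Finite := by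
    intro c
    have hm : Measurable fun q : Grain d × Grain d => q.1.meetTime q.2 :=
      measurable_fst.meetTime measurable_snd
    refine ae_finite_related hΨ ha hM (measurableSet_le hm measurable_const)
      (F := fun p => ballConst d c * p.2.mass) (G := fun p => p.2.mass)
      (by fun_prop) (by fun_prop) ?_ hmass ?_
    · rw [lintegral_const_mul' _ _ (ballConst_ne_top _)]
      exact ENNReal.mul_ne_top (ballConst_ne_top _) hmass
    · intro u p
      rw [mul_assoc]
      refine le_trans (measure_mono fun x hx => ?_) (volume_closedBall_le u.pos c u.shape p.2)
      obtain ⟨-, -, h3⟩ := Grain.dist_pos_pos_le (show u.meetTime ((x, p) : Grain d) ≤ c from hx)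
      refine le_trans (show dist x u.pos ≤ _ from h3) ?_
      rw [mul_add]
      refine add_le_add ?_ ?_
      · exact mul_le_mul_of_nonneg_right (sub_le_self _ (NNReal.coe_nonneg _)) (NNReal.coe_nonneg _)
      · exact mul_le_mul_of_nonneg_right (sub_le_self _ (NNReal.coe_nonneg _)) (NNReal.coe_nonneg _)
  filter_upwards [ae_all_iff.2 h] with ω hω u hu c
  obtain ⟨n, hn⟩ := exists_nat_ge c
  refine ((hω n u hu).insert u).subset fun v hv => ?_
  rcases eq_or_ne v u with hvu | hvu
  · exact Or.inl hvu
  · exact Or.inr ⟨hv.1, hvu, hv.2.trans hn⟩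

/-- A covered grain with birth time t lies within t times the radius of `u`, so a d-th moment of the
birth time suffices. -/
lemma ae_finite_covers (hΨ : Measurable Ψ) (ha : a ≠ ∞) (hM : MomentBound P Ψ a Q)
    (hmass : ∫⁻ p, p.2.mass ∂Q ≠ ∞) (hbirth : ∫⁻ p, (p.1 : ℝ≥0∞) ^ d ∂Q ≠ ∞) :
    ∀ᵐ ω ∂P, ∀ u ∈ (Ψ ω).carrier, {v ∈ (Ψ ω).carrier | u.Covers v}.Finite := by
  set κ := volume (ball (0 : EuclideanSpace ℝ (Fin d)) 1)
  have hκ : κ ≠ ∞ := measure_ball_lt_top.ne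
  have h := ae_finite_related hΨ ha hM
      (S := {q : Grain d × Grain d | q.1.Covers q.2})
      (Grain.measurableSet_covers measurable_fst measurable_snd)
      (F := fun p => κ * p.2.mass) (G := fun p => (p.1 : ℝ≥0∞) ^ d)
      (by fun_prop) (by fun_prop) (by
        rw [lintegral_const_mul' _ _ hκ]
        exact ENNReal.mul_ne_top hκ hmass) hbirth (by
        intro u p
        have h1 : {x : EuclideanSpace ℝ (Fin d) |
            (u, ((x, p) : Grain d)) ∈ {q : Grain d × Grain d | q.1.Covers q.2}} ⊆
            closedBall u.pos ((p.1 * u.shape.rad : ℝ≥0) : ℝ) := by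
          intro x hx
          have hx : u.arrival x ≤ p.1 := hx
          rw [mem_closedBall, NNReal.coe_mul]
          exact u.dist_pos_le (le_trans le_add_self hx)
        refine (measure_mono h1).trans ?_
        rw [volume_closedBall_eq, ENNReal.coe_mul, mul_pow]
        calc _ ≤ (p.1 : ℝ≥0∞) ^ d * u.shape.mass * κ := by
              gcongr
              exact coe_pow_rad_le_mass _
          _ = κ * u.shape.mass * (p.1 : ℝ≥0∞) ^ d := by ring)
  filter_upwards [h] with ω hω u hu
  refine ((hω u hu).insert u).subset fun v hv => ?_
  rcases eq_or_ne v u with hvu | hvu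
  · exact Or.inl hvu
  · exact Or.inr ⟨hv.1, hvu, hv.2⟩

lemma ae_growthTime_spec (hΨ : Measurable Ψ)
    (hcard : ∀ᵐ ω ∂P, (Ψ ω).carrier = ∅ ∨ (Ψ ω).carrier.Infinite)
    (ha : a ≠ ∞) (hM : MomentBound P Ψ a Q)
    (hmom : ∫⁻ p, ENNReal.ofReal
      (((p.1 : ℝ) ^ (2 * d) + 1) * (p.2.circumradius ^ (2 * d) + 1)) ∂Q < ∞) :
    ∀ᵐ ω ∂P, IsGrowthMaximal (fun u : (Ψ ω).carrier => (u : Grain d))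
        (fun u => growthTime (Ψ ω, u)) ∧
      ∀ r : (Ψ ω).carrier → ℝ≥0, IsGrowthMaximal (fun u : (Ψ ω).carrier => (u : Grain d)) r →
        ∀ u : (Ψ ω).carrier, r u = growthTime (Ψ ω, u) := by
  have hempty : ∀ ω, (Ψ ω).carrier = ∅ →
      IsGrowthMaximal (fun u : (Ψ ω).carrier => (u : Grain d))
        (fun u => growthTime (Ψ ω, u)) ∧
      ∀ r : (Ψ ω).carrier → ℝ≥0, IsGrowthMaximal (fun u : (Ψ ω).carrier => (u : Grain d)) r →
        ∀ u : (Ψ ω).carrier, r u = growthTime (Ψ ω, u) := by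
    intro ω hω
    have : IsEmpty (Ψ ω).carrier := isEmpty_coe_sort.2 hω
    exact ⟨⟨isEmptyElim, isEmptyElim, isEmptyElim⟩, fun _ _ => isEmptyElim⟩
  rcases Nat.eq_zero_or_pos d with rfl | hd
  -- In dimension 0 distinct positions allow at most one grain, so an infinite configuration is
  -- impossible.
  · filter_upwards [hcard] with ω hω
    refine hempty ω (hω.resolve_right fun hinf => hinf ?_)
    refine Set.Subsingleton.finite fun u hu v hv => ?_
    by_contra huv
    exact (Ψ ω).pos_ne u hu v hv huv (Subsingleton.elim _ _)
  · have hmass := (lintegral_mass_lt_top hmom).ne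
    have hpath := exists_ae_not_exists_windowPath hd hΨ ha hM hmass
      (lintegral_mass_sq_lt_top hmom).ne
    choose ε hε hpath using hpath
    filter_upwards [hcard, ae_finite_meetTime_le hΨ ha hM hmass,
      ae_finite_covers hΨ ha hM hmass (lintegral_birth_pow_lt_top hmom).ne,
      ae_all_iff.2 hpath] with ω hω hfin hcov hp
    rcases hω with hω | hinf
    · exact hempty ω hω
    · exact growthTime_spec hd _ hinf
        (wellFounded_precedes (Ψ ω).pos_ne hfin fun M => ⟨ε M, hε M, hp M⟩) hfin hcov

end

end GrowthModel

end

/-- Existence and almost sure uniqueness of the growth-maximal hard-core model based on a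
space-time point process `Ψ` of convex grains. The growth time of a grain `u` of `Ψ` is
`R (Ψ, u)` with a measurable function `R`; in terms of an enumeration `(X_n, T_n, Z_n) = G n` of
`Ψ` the growth times are `R_n = R (Ψ, G n)`. -/
theorem theorem2p1 {d : ℕ} {Ω : Type*} [MeasurableSpace Ω] (P : Measure Ω) [IsProbabilityMeasure P]
    (Ψ : Ω → GrowthModel.Config d) (hΨ : Measurable Ψ)
    (hcard : ∀ᵐ ω ∂P, (Ψ ω).carrier = ∅ ∨ (Ψ ω).carrier.Infinite)
    (a : ℝ) (ha : 0 < a)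
    (Q : Measure (ℝ≥0 × GrowthModel.Shape d)) [IsProbabilityMeasure Q]
    (hfac : ∀ k : ℕ, 1 ≤ k → ∀ C : Set (Fin k → GrowthModel.Grain d), MeasurableSet C →
      GrowthModel.factorialMoment P Ψ k C ≤
        ENNReal.ofReal a ^ k *
          Measure.pi (fun _ : Fin k =>
            (volume : Measure (EuclideanSpace ℝ (Fin d))).prod Q) C)
    (hmom : ∫⁻ p, ENNReal.ofReal
      (((p.1 : ℝ) ^ (2 * d) + 1) * (p.2.circumradius ^ (2 * d) + 1)) ∂Q < ∞) :
    ∃ R : GrowthModel.Config d × GrowthModel.Grain d → ℝ≥0,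
      Measurable R ∧
      -- almost surely, the growth times `R (Ψ, u)` form a growth-maximal hard-core model
      (∀ᵐ ω ∂P, GrowthModel.IsGrowthMaximal
        (fun u : (Ψ ω).carrier => (u : GrowthModel.Grain d))
        (fun u : (Ψ ω).carrier => R (Ψ ω, u))) ∧
      -- almost surely, there are no other growth times with this property
      (∀ᵐ ω ∂P, ∀ r : (Ψ ω).carrier → ℝ≥0,
        GrowthModel.IsGrowthMaximal
          (fun u : (Ψ ω).carrier => (u : GrowthModel.Grain d)) r →
        ∀ u : (Ψ ω).carrier, r u = R (Ψ ω, u)) ∧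
      -- the same for the sequence of growth times belonging to any enumeration of `Ψ`
      (∀ G : ℕ → Ω → GrowthModel.Grain d,
        (∀ᵐ ω ∂P, Function.Injective (fun n => G n ω) ∧
          Set.range (fun n => G n ω) = (Ψ ω).carrier) →
        (∀ n, Measurable[MeasurableSpace.comap Ψ inferInstance] (G n) →
          Measurable[MeasurableSpace.comap Ψ inferInstance] (fun ω => R (Ψ ω, G n ω))) ∧
        (∀ᵐ ω ∂P, GrowthModel.IsGrowthMaximal (fun n => G n ω) (fun n => R (Ψ ω, G n ω))) ∧
        (∀ R' : ℕ → Ω → ℝ≥0,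
          (∀ᵐ ω ∂P, GrowthModel.IsGrowthMaximal (fun n => G n ω) (fun n => R' n ω)) →
          ∀ n, ∀ᵐ ω ∂P, R' n ω = R (Ψ ω, G n ω))) := by
  have hM : GrowthModel.MomentBound P Ψ (ENNReal.ofReal a) Q := hfac
  have hspec := GrowthModel.ae_growthTime_spec hΨ hcard ENNReal.ofReal_ne_top hM hmom
  refine ⟨GrowthModel.growthTime, GrowthModel.measurable_growthTime, hspec.mono fun ω h => h.1,
    hspec.mono fun ω h => h.2, fun G hG => ⟨fun n hn => ?_, ?_, fun R' hR' n => ?_⟩⟩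
  · exact GrowthModel.measurable_growthTime.comp ((comap_measurable Ψ).prodMk hn)
  · filter_upwards [hspec, hG] with ω h hω
    obtain ⟨e, he⟩ := GrowthModel.exists_equiv_of_range_eq hω.1 hω.2
    simpa only [Function.comp_def, he] using h.1.comp_equiv e
  · filter_upwards [hspec, hG, hR'] with ω h hω hr
    obtain ⟨e, he⟩ := GrowthModel.exists_equiv_of_range_eq hω.1 hω.2
    -- A competing sequence is reindexed by the grains themselves, where uniqueness is known.
    have hcomp : (fun n => G n ω) ∘ e.symm = fun u : (Ψ ω).carrier => (u : GrowthModel.Grain d) :=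
      funext fun u => by rw [Function.comp_apply, ← he, e.apply_symm_apply]
    have hr' := hr.comp_equiv e.symm
    rw [hcomp] at hr'
    have := h.2 _ hr' (e n)
    rwa [Function.comp_apply, e.symm_apply_apply, he] at this
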